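/- Let $(M,J,g)$ be an almost Hermitian manifold of real dimension $2n$: $J$ is a smooth almost complex structure and $g=\langle\cdot,\cdot\rangle$ a smooth Riemannian metric with $g(JX,JY)=g(X,Y)$. Let $D$ be the Levi-Civita connection and let $\nabla$ be the canonical connection, i.e. the connection with $\nabla g=0$, $\nabla J=0$ whose torsion $\tau(X,Y)=\nabla_XY-\nabla_YX-[X,Y]$ satisfies $\tau(X,\overline Y)=0$ for all $(1,0)$-vectors $X,Y$. All tensors, the connections and the Lie bracket are extended complex (multi)linearly to $TM\otimes\mathbb C$. Let $R^L$ and $R$ be the curvature tensors of $D$ and $\nabla$, with the convention $R(X,Y,Z,W)=\langle R(Z,W)X,Y\rangle$, $R(X,Y)Z=\nabla_X\nabla_YZ-\nabla_Y\nabla_XZ-\nabla_{[X,Y]}Z$ (and likewise for $R^L$ with $D$). Fix a smooth local unitary $(1,0)$-frame $(e_1,\dots,e_n)$, i.e. $Je_i=\sqrt{-1}\,e_i$ and $\langle e_i,\overline{e_j}\rangle=\delta_{ij}$, and put $e_{\bar i}=\overline{e_i}$. Write $R_{ABCD}=R(e_A,e_B,e_C,e_D)$ (likewise $R^L_{ABCD}$),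 let $\tau_{AB}^C$ be the component of $\tau(e_A,e_B)$ along $e_C$, and let $\tau_{AB;C}^D$ be the component of $(\nabla_{e_C}\tau)(e_A,e_B)$ along $e_D$. Then at every point of the domain of the frame, for all $i,j,k,l\in\{1,\dots,n\}$, with summation over the repeated index $\lambda\in\{1,\dots,n\}$, $$ \begin{aligned} R^L_{ijk\bar l}={}&\tfrac12\left(R_{k\bar l ij}-R_{i\bar l jk}-R_{j\bar l ki}\right)+\tfrac12\left(\tau_{ij;k}^{l}-\tau_{ij}^{\bar\lambda}\tau_{\bar l\bar\lambda}^{\bar k}\right)+\tfrac14\left(\tau_{j\lambda}^{l}\tau_{ik}^{\lambda}-\tau_{i\lambda}^{l}\tau_{jk}^{\lambda}\right)\\ &+\tfrac14\tau_{\bar l\bar\lambda}^{\bar i}\left(\tau_{jk}^{\bar\lambda}-\tau_{k\lambda}^{\bar j}+\tau_{\lambda j}^{\bar k}\right)-\tfrac14\tau_{\bar l\bar\lambda}^{\bar j}\left(\tau_{ik}^{\bar\lambda}-\tau_{k\lambda}^{\bar i}+\tau_{\lambda i}^{\bar k}\right). \end{aligned} $$ Moreover, if $(M,J,g)$ is quasi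 Kähler, i.e. $\bar\partial\omega=0$ (the $(1,2)$-part of $d\omega$ vanishes) for $\omega(X,Y)=g(JX,Y)$, then $R^L_{ijk\bar l}=R_{k\bar l ij}$ for all $i,j,k,l$; and if $(M,J,g)$ is nearly Kähler, i.e. $(D_XJ)X=0$ for every vector field $X$, then $R^L_{ijk\bar l}=0$ for all $i,j,k,l$. -/

import Mathlib

open Bundle VectorField
open scoped Manifold ContDiff

noncomputable section

namespace AlmostHermitian

/-- The complexification `V ⊗ ℂ = V ⊕ √-1 V` of a real vector space `V`;
`⟨a, b⟩` stands for `a + √-1 b`. -/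
@[ext]
structure Cplx (V : Type*) where
  re : V
  im : V

namespace Cplx

variable {V W : Type*} [AddCommGroup V]

instance : Zero (Cplx V) := ⟨⟨0, 0⟩⟩
instance : Add (Cplx V) := ⟨fun v w => ⟨v.re + w.re, v.im + w.im⟩⟩
instance : Neg (Cplx V) := ⟨fun v => ⟨-v.re, -v.im⟩⟩
instance : Sub (Cplx V) := ⟨fun v w => ⟨v.re - w.re, v.im - w.im⟩⟩

@[simp] theorem zero_re : (0 : Cplx V).re = 0 := rfl
@[simp] theorem zero_im : (0 : Cplx V).im = 0 := rfl
@[simp] theorem add_re (v w : Cplx V) : (v + w).re = v.re + w.re := rfl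
@[simp] theorem add_im (v w : Cplx V) : (v + w).im = v.im + w.im := rfl
@[simp] theorem neg_re (v : Cplx V) : (-v).re = -v.re := rfl
@[simp] theorem neg_im (v : Cplx V) : (-v).im = -v.im := rfl
@[simp] theorem sub_re (v w : Cplx V) : (v - w).re = v.re - w.re := rfl
@[simp] theorem sub_im (v w : Cplx V) : (v - w).im = v.im - w.im := rfl
instance : AddCommGroup (Cplx V) where
  add_assoc u v w := by ext <;> simp [add_assoc]
  zero_add v := by ext <;> simp
  add_zero v := by ext <;> simp
  add_comm v w := by ext <;> simp [add_comm]
  neg_add_cancel v := by ext <;> simp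
  sub_eq_add_neg v w := by ext <;> simp [sub_eq_add_neg]
  nsmul := nsmulRec
  zsmul := zsmulRec

/-- Complex conjugation `a + √-1 b ↦ a - √-1 b`. -/
def conj (v : Cplx V) : Cplx V := ⟨v.re, -v.im⟩

variable [Module ℝ V] [AddCommGroup W] [Module ℝ W]

instance : SMul ℂ (Cplx V) :=
  ⟨fun z v => ⟨z.re • v.re - z.im • v.im, z.re • v.im + z.im • v.re⟩⟩

@[simp] theorem smul_re (z : ℂ) (v : Cplx V) : (z • v).re = z.re • v.re - z.im • v.im := rfl
@[simp] theorem smul_im (z : ℂ) (v : Cplx V) : (z • v).im = z.re • v.im + z.im • v.re := rfl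

instance : Module ℂ (Cplx V) where
  one_smul v := by ext <;> simp
  mul_smul z w v := by ext <;> simp <;> module
  smul_zero z := by ext <;> simp
  smul_add z v w := by ext <;> simp <;> module
  add_smul z w v := by ext <;> simp <;> module
  zero_smul v := by ext <;> simp

/-- The `ℂ`-linear extension of a real-linear map. -/
def map (f : V →ₗ[ℝ] W) (v : Cplx V) : Cplx W := ⟨f v.re, f v.im⟩

end Cplx

variable {E : Type*} [NormedAddCommGroup E] [NormedSpace ℝ E] [FiniteDimensional ℝ E]
  [CompleteSpace E]
  {H : Type*} [TopologicalSpace H] {I : ModelWithCorners ℝ E H}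
  {M : Type*} [TopologicalSpace M] [ChartedSpace H M] [IsManifold I ∞ M]

variable (I M) in
/-- A smooth almost complex structure on `M`. -/
structure AlmostComplexStructure where
  /-- The endomorphism of each tangent space. -/
  toFun : ∀ x : M, TangentSpace I x →L[ℝ] TangentSpace I x
  smooth : ContMDiff I (I.prod 𝓘(ℝ, E →L[ℝ] E)) ∞
    (fun x => TotalSpace.mk' (E →L[ℝ] E) (E := fun x : M => TangentSpace I x →L[ℝ] TangentSpace I x)
      x (toFun x))
  sq : ∀ (x : M) (v : TangentSpace I x), toFun x (toFun x v) = -v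

instance : CoeFun (AlmostComplexStructure I M)
    (fun _ => ∀ x : M, TangentSpace I x →L[ℝ] TangentSpace I x) :=
  ⟨AlmostComplexStructure.toFun⟩

variable (I M) in
/-- Complex vector fields, i.e. sections of `TM ⊗ ℂ`. -/
abbrev CField := ∀ x : M, Cplx (TangentSpace I x)

/-- Both the real and the imaginary part are differentiable at `x`. -/
def CField.MDiffAt (X : CField I M) (x : M) : Prop :=
  MDifferentiableAt I I.tangent (fun y => (⟨y, (X y).re⟩ : TangentBundle I M)) x ∧
  MDifferentiableAt I I.tangent (fun y => (⟨y, (X y).im⟩ : TangentBundle I M)) x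

/-- Both the real and the imaginary part are smooth on `u`. -/
def CField.SmoothOn (X : CField I M) (u : Set M) : Prop :=
  ContMDiffOn I I.tangent ∞ (fun y => (⟨y, (X y).re⟩ : TangentBundle I M)) u ∧
  ContMDiffOn I I.tangent ∞ (fun y => (⟨y, (X y).im⟩ : TangentBundle I M)) u

/-- The conjugate complex vector field. -/
def CField.conj (X : CField I M) : CField I M := fun x => (X x).conj

/-- A complex tangent vector `v` at `x` is of type `(1,0)` if `J v = √-1 v`. -/
def IsType10 (J : AlmostComplexStructure I M) {x : M} (v : Cplx (TangentSpace I x)) : Prop :=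
  v.map (J x : TangentSpace I x →ₗ[ℝ] TangentSpace I x) = Complex.I • v

/-- The `ℂ`-bilinear extension of the Lie bracket to complex vector fields. -/
def cbracket (X Y : CField I M) : CField I M := fun x =>
  ⟨mlieBracket I (fun y => (X y).re) (fun y => (Y y).re) x
      - mlieBracket I (fun y => (X y).im) (fun y => (Y y).im) x,
    mlieBracket I (fun y => (X y).re) (fun y => (Y y).im) x
      + mlieBracket I (fun y => (X y).im) (fun y => (Y y).re) x⟩

/-- The derivative `X f` of a complex function `f` along a complex vector `v` at `x`. -/
def cderiv (f : M → ℂ) (x : M) (v : Cplx (TangentSpace I x)) : ℂ :=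
  mvfderiv I f x v.re + Complex.I * mvfderiv I f x v.im

section Connection

variable (cov : CovariantDerivative I E (TangentSpace I : M → Type _))

/-- A connection is smooth if the covariant derivative of every smooth (local) vector field
is smooth. -/
def IsSmoothConnection : Prop :=
  ∀ u : Set M, IsOpen u → ContMDiffCovariantDerivativeOn E ∞ cov.toFun u

/-- `∇_X Y` for complex vector fields, extended `ℂ`-bilinearly. -/
def ccov (X Y : CField I M) : CField I M := fun x =>
  ⟨cov (fun y => (Y y).re) x (X x).re - cov (fun y => (Y y).im) x (X x).im,
    cov (fun y => (Y y).im) x (X x).re + cov (fun y => (Y y).re) x (X x).im⟩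

/-- The torsion `τ`, extended `ℂ`-bilinearly. -/
def ctorsion (x : M) (v w : Cplx (TangentSpace I x)) : Cplx (TangentSpace I x) :=
  ⟨cov.torsion x v.re w.re - cov.torsion x v.im w.im,
    cov.torsion x v.re w.im + cov.torsion x v.im w.re⟩

/-- `(∇_Z τ)(X, Y) = ∇_Z (τ(X, Y)) - τ(∇_Z X, Y) - τ(X, ∇_Z Y)`. -/
def ccovTorsion (Z X Y : CField I M) : CField I M :=
  ccov cov Z (fun y => ctorsion cov y (X y) (Y y))
    - (fun x => ctorsion cov x (ccov cov Z X x) (Y x))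
    - (fun x => ctorsion cov x (X x) (ccov cov Z Y x))

/-- The curvature operator `R(X, Y) Z = ∇_X ∇_Y Z - ∇_Y ∇_X Z - ∇_{[X, Y]} Z`. -/
def ccurv (X Y Z : CField I M) : CField I M :=
  ccov cov X (ccov cov Y Z) - ccov cov Y (ccov cov X Z) - ccov cov (cbracket X Y) Z

/-- `(∇_v J) Y` at `x`, for a real tangent vector `v` and a real vector field `Y`. -/
def covJ (J : AlmostComplexStructure I M) (Y : ∀ x : M, TangentSpace I x) (x : M)
    (v : TangentSpace I x) : TangentSpace I x :=
  cov (fun y => J y (Y y)) x v - J x (cov Y x v)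

end Connection

/-- The indices `1, …, n` (`hol i`) and `1̄, …, n̄` (`bar i`) of a complex frame
`e₁, …, eₙ, ē₁, …, ēₙ`. -/
inductive Idx (n : ℕ)
  | hol (i : Fin n)
  | bar (i : Fin n)

/-- The conjugate index. -/
def Idx.conj {n : ℕ} : Idx n → Idx n
  | .hol i => .bar i
  | .bar i => .hol i

/-- The frame `(e_A)`, where `e_ī` is the conjugate of `e_i`. -/
def fr {n : ℕ} (e : Fin n → CField I M) : Idx n → CField I M
  | .hol i => e i
  | .bar i => (e i).conj

section Metric

variable (g : ContMDiffRiemannianMetric I ∞ E (fun x : M => TangentSpace I x))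

/-- The Riemannian metric, extended `ℂ`-bilinearly to complex tangent vectors. -/
def cinner {x : M} (v w : Cplx (TangentSpace I x)) : ℂ :=
  ⟨g.inner x v.re w.re - g.inner x v.im w.im, g.inner x v.re w.im + g.inner x v.im w.re⟩

/-- The metric is almost Hermitian for `J`: `g(JX, JY) = g(X, Y)`. -/
def IsAlmostHermitian (J : AlmostComplexStructure I M) : Prop :=
  ∀ (x : M) (v w : TangentSpace I x), g.inner x (J x v) (J x w) = g.inner x v w

/-- The fundamental form `ω(X, Y) = g(JX, Y)`, extended `ℂ`-bilinearly. -/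
def fundForm (J : AlmostComplexStructure I M) {x : M} (v w : Cplx (TangentSpace I x)) : ℂ :=
  cinner g (v.map (J x : TangentSpace I x →ₗ[ℝ] TangentSpace I x)) w

/-- The exterior derivative `dω(X, Y, Z)` of the fundamental form, by the invariant formula. -/
def dFundForm (J : AlmostComplexStructure I M) (X Y Z : CField I M) (x : M) : ℂ :=
  cderiv (fun y => fundForm g J (Y y) (Z y)) x (X x)
    - cderiv (fun y => fundForm g J (X y) (Z y)) x (Y x)
    + cderiv (fun y => fundForm g J (X y) (Y y)) x (Z x)
    - fundForm g J (cbracket X Y x) (Z x)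
    + fundForm g J (cbracket X Z x) (Y x)
    - fundForm g J (cbracket Y Z x) (X x)

/-- Quasi Kähler: `∂̄ω = 0`, i.e. the `(1,2)`-part of the three-form `dω` vanishes. -/
def IsQuasiKahler (J : AlmostComplexStructure I M) : Prop :=
  ∀ (x : M) (X Y Z : CField I M), X.MDiffAt x → Y.MDiffAt x → Z.MDiffAt x →
    IsType10 J (X x) → IsType10 J (Y x) → IsType10 J (Z x) →
    dFundForm g J X Y.conj Z.conj x = 0

/-- A local unitary `(1,0)`-frame on `u`. When `M` has real dimension `2 n`, the `n` vectors
`e i x` are then a basis of the space of `(1,0)`-vectors at each point `x` of `u`. -/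
structure IsUnitaryFrameOn (J : AlmostComplexStructure I M) {n : ℕ}
    (e : Fin n → CField I M) (u : Set M) : Prop where
  smooth : ∀ i, (e i).SmoothOn u
  type10 : ∀ i, ∀ x ∈ u, IsType10 J (e i x)
  unitary : ∀ i j, ∀ x ∈ u, cinner g (e i x) ((e j).conj x) = if i = j then 1 else 0

section Components

variable (cov : CovariantDerivative I E (TangentSpace I : M → Type _))
  {n : ℕ} (e : Fin n → CField I M) (x : M)

/-- The component of `v` along `e_A` in a unitary frame: since `⟨e_i, ē_j⟩ = δ_ij` and
`⟨e_i, e_j⟩ = 0`, it is the pairing of `v` with `e_Ā`. -/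
def coord (v : Cplx (TangentSpace I x)) (A : Idx n) : ℂ := cinner g v (fr e A.conj x)

/-- `R_{ABCD} = ⟨R(e_C, e_D) e_A, e_B⟩`. -/
def curv (A B C D : Idx n) : ℂ :=
  cinner g (ccurv cov (fr e C) (fr e D) (fr e A) x) (fr e B x)

/-- `τ_{AB}^C`, the component along `e_C` of `τ(e_A, e_B)`. -/
def tor (A B C : Idx n) : ℂ := coord g e x (ctorsion cov x (fr e A x) (fr e B x)) C

/-- `τ_{AB;C}^D`, the component along `e_D` of `(∇_{e_C} τ)(e_A, e_B)`. -/
def dtor (A B C D : Idx n) : ℂ :=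
  coord g e x (ccovTorsion cov (fr e C) (fr e A) (fr e B) x) D

end Components

/-- `∇g = 0`, i.e. `v ⟨Y, Z⟩ = ⟨∇_v Y, Z⟩ + ⟨Y, ∇_v Z⟩` for every tangent vector `v`. -/
def IsMetric (cov : CovariantDerivative I E (TangentSpace I : M → Type _)) : Prop :=
  ∀ (x : M) (Y Z : ∀ y : M, TangentSpace I y),
    MDifferentiableAt I I.tangent (fun y => (⟨y, Y y⟩ : TangentBundle I M)) x →
    MDifferentiableAt I I.tangent (fun y => (⟨y, Z y⟩ : TangentBundle I M)) x →
    ∀ v : TangentSpace I x,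
      mvfderiv I (fun y => g.inner y (Y y) (Z y)) x v
        = g.inner x (cov Y x v) (Z x) + g.inner x (Y x) (cov Z x v)

/-- The Levi-Civita connection: metric and torsion-free. -/
structure IsLeviCivita (D : CovariantDerivative I E (TangentSpace I : M → Type _)) : Prop where
  smooth : IsSmoothConnection D
  metric : IsMetric g D
  torsion_eq_zero : ∀ x, D.torsion x = 0

/-- The canonical connection: `∇g = 0`, `∇J = 0`, and the `(1,1)`-part of the torsion vanishes. -/
structure IsCanonical (J : AlmostComplexStructure I M)
    (cov : CovariantDerivative I E (TangentSpace I : M → Type _)) : Prop where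
  smooth : IsSmoothConnection cov
  metric : IsMetric g cov
  parallel : ∀ (x : M) (Y : ∀ y : M, TangentSpace I y),
    MDifferentiableAt I I.tangent (fun y => (⟨y, Y y⟩ : TangentBundle I M)) x →
    ∀ v : TangentSpace I x, covJ cov J Y x v = 0
  torsion11 : ∀ (x : M) (v w : Cplx (TangentSpace I x)), IsType10 J v → IsType10 J w →
    ctorsion cov x v w.conj = 0

/-- Nearly Kähler: `(D_X J) X = 0` for every vector field `X`, where `D` is the Levi-Civita
connection. -/
def IsNearlyKahler (J : AlmostComplexStructure I M)
    (D : CovariantDerivative I E (TangentSpace I : M → Type _)) : Prop :=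
  ∀ (x : M) (X : ∀ y : M, TangentSpace I y),
    MDifferentiableAt I I.tangent (fun y => (⟨y, X y⟩ : TangentBundle I M)) x →
    covJ D J X x (X x) = 0

end Metric

end AlmostHermitian

end

open AlmostHermitian AlmostHermitian.Idx

set_option linter.unusedSectionVars false

noncomputable section

namespace AlmostHermitian

open TopologicalSpace (Opens)

/-! Write S = D - ∇. Both connections are metric, so S(X, ·) is skew, and D is torsion-free, so
S(X,Y) - S(Y,X) = -τ(X,Y). As in the Koszul formula, these two facts determine S by the torsion
(`two_ip_diff`). Substituting D = ∇ + S into the curvature expresses R^L through R, ∇τ and products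
of S (`two_ip_curvLC`).

For R^L_{ijkl̄} = ⟨R^L(e_k, e_l̄)e_i, e_j⟩, types remove most terms. The connection ∇ preserves
types, the complex metric pairs (1,0) only with (0,1), and τ has no (1,1)-part. What remains is
τ_{ij;k}^l, three components of ∇_{l̄}τ, and two products of S (`two_ip_curvLC_hol`). The first
Bianchi identity with torsion, paired with a (1,0)-vector, exchanges each component of ∇_{l̄}τ for a
curvature of ∇ and a product of torsions (`ip_dtor_anti`). Expanding the products in the unitary
frame gives the formula (`curv_lc_formula`).

The (1,2)-part of dω is, up to a factor, the component of τ on two (0,1)-vectors paired with a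
(1,0)-vector (`dOmega_hol_anti_anti`). Hence on a quasi Kähler manifold τ sends pairs of
(1,0)-vectors to (0,1)-vectors. Every torsion term of the formula then vanishes, as does the right
side of the Bianchi identity, so R_{kl̄ij} has cyclic sum zero in i, j, k (`curv_nab_cyclic`) and
R^L_{ijkl̄} = R_{kl̄ij}. On a nearly Kähler manifold the same holds, and ⟨τ(e_i,e_j),e_k⟩ is
moreover totally skew. Now R_{kl̄ij} = -⟨(∇_{l̄}τ)(e_i,e_j),e_k⟩ is totally skew too, its three
cyclic terms coincide, and it is zero.

All of this is algebra over the identities collected in `HermitianCalculus`. The geometric work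
consists in showing that smooth complex fields on an open set satisfy them (`fieldCalculus`). -/

/-- The algebra behind a Levi-Civita connection `lc` and a Hermitian connection `nab` without
torsion of type `(1,1)`: fields form a complex vector space `V`, functions a complex vector
space `F`, and all operations are complex multilinear. -/
structure HermitianCalculus (V F : Type*) [AddCommGroup V] [Module ℂ V] [AddCommGroup F]
    [Module ℂ F] where
  ip : V →ₗ[ℂ] V →ₗ[ℂ] F
  dv : V →ₗ[ℂ] F →ₗ[ℂ] F
  br : V →ₗ[ℂ] V →ₗ[ℂ] V
  nab : V →ₗ[ℂ] V →ₗ[ℂ] V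
  lc : V →ₗ[ℂ] V →ₗ[ℂ] V
  J : V →ₗ[ℂ] V
  ip_symm : ∀ X Y, ip X Y = ip Y X
  br_skew : ∀ X Y, br X Y = -br Y X
  jacobi : ∀ X Y Z, br X (br Y Z) = br (br X Y) Z + br Y (br X Z)
  dv_br : ∀ X Y f, dv (br X Y) f = dv X (dv Y f) - dv Y (dv X f)
  nab_metric : ∀ X Y Z, dv X (ip Y Z) = ip (nab X Y) Z + ip Y (nab X Z)
  lc_metric : ∀ X Y Z, dv X (ip Y Z) = ip (lc X Y) Z + ip Y (lc X Z)
  lc_torsion : ∀ X Y, lc X Y - lc Y X = br X Y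
  nab_J : ∀ X Y, nab X (J Y) = J (nab X Y)
  J_sq : ∀ X, J (J X) = -X
  ip_J : ∀ X Y, ip (J X) (J Y) = ip X Y
  torsion11 : ∀ X Y, J X = Complex.I • X → J Y = -(Complex.I • Y) →
    nab X Y - nab Y X - br X Y = 0

/-! ### Torsion, difference tensor and curvature of two metric connections -/

namespace HermitianCalculus

variable {V F : Type*} [AddCommGroup V] [Module ℂ V] [AddCommGroup F] [Module ℂ F]
  (C : HermitianCalculus V F)

/-- The torsion of `nab`. -/
def tor (X Y : V) : V := C.nab X Y - C.nab Y X - C.br X Y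

/-- The covariant derivative `(∇_Z τ)(X, Y)` of the torsion. -/
def dtor (Z X Y : V) : V :=
  C.nab Z (C.tor X Y) - C.tor (C.nab Z X) Y - C.tor X (C.nab Z Y)

/-- The curvature operator of `nab`. -/
def curvNab (X Y Z : V) : V :=
  C.nab X (C.nab Y Z) - C.nab Y (C.nab X Z) - C.nab (C.br X Y) Z

/-- The curvature operator of `lc`. -/
def curvLC (X Y Z : V) : V :=
  C.lc X (C.lc Y Z) - C.lc Y (C.lc X Z) - C.lc (C.br X Y) Z

/-- The difference `lc - nab`. -/
def diff (X Y : V) : V := C.lc X Y - C.nab X Y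

/-- Fields of type `(1,0)`. -/
def Hol (X : V) : Prop := C.J X = Complex.I • X

/-- Fields of type `(0,1)`. -/
def Anti (X : V) : Prop := C.J X = -(Complex.I • X)

variable {C}

theorem tor_skew (X Y : V) : C.tor X Y = -C.tor Y X := by
  simp only [tor, C.br_skew X Y]; abel

/-- Both connections differentiate the same function ⟨Y, Z⟩ by the product rule; subtract the two
rules. -/
theorem diff_skew (X Y Z : V) : C.ip (C.diff X Y) Z = -C.ip Y (C.diff X Z) := by
  have h1 := C.nab_metric X Y Z
  have h2 := C.lc_metric X Y Z
  simp only [diff, map_sub, LinearMap.sub_apply]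
  linear_combination (norm := module) h1 - h2

theorem diff_sub_swap (X Y : V) : C.diff X Y - C.diff Y X = -C.tor X Y := by
  have h1 := C.lc_torsion X Y
  simp only [diff, tor]
  linear_combination (norm := module) h1

/-- A trilinear expression skew in its last two slots is determined by its skew part in the first
two. This is the cyclic permutation argument of the Koszul formula. -/
theorem two_ip_diff (X Y Z : V) : (2 : ℂ) • C.ip (C.diff X Y) Z =
    -C.ip (C.tor X Y) Z + C.ip (C.tor Y Z) X - C.ip (C.tor Z X) Y := by
  have h : ∀ A B W, C.ip (C.diff A B) W - C.ip (C.diff B A) W = -C.ip (C.tor A B) W := by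
    intro A B W
    rw [← LinearMap.sub_apply, ← map_sub, diff_sub_swap, map_neg, LinearMap.neg_apply]
  have s : ∀ A B W, C.ip (C.diff A B) W = -C.ip (C.diff A W) B := by
    intro A B W
    rw [diff_skew, C.ip_symm]
  have h1 := h X Y Z
  have h2 := h Y Z X
  have h3 := h Z X Y
  have s1 := s X Y Z
  have s2 := s Y Z X
  have s3 := s Z X Y
  linear_combination (norm := module) h1 - h2 + h3 + s1 + s2 - s3

theorem dv_ip_tor (W X Y Z : V) : C.dv W (C.ip (C.tor X Y) Z) =
    C.ip (C.dtor W X Y) Z + C.ip (C.tor (C.nab W X) Y) Z + C.ip (C.tor X (C.nab W Y)) Z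
      + C.ip (C.tor X Y) (C.nab W Z) := by
  rw [C.nab_metric]
  simp only [dtor, map_sub, LinearMap.sub_apply]
  abel

/-- Apply [X,Y]f = XYf - YXf to f = ⟨Z, W⟩: the mixed terms ⟨∇Z, ∇W⟩ cancel by symmetry. -/
theorem curvNab_skew (X Y Z W : V) :
    C.ip (C.curvNab X Y Z) W = -C.ip (C.curvNab X Y W) Z := by
  have h := C.dv_br X Y (C.ip Z W)
  simp only [C.nab_metric, map_add] at h
  simp only [curvNab, map_sub, LinearMap.sub_apply]
  rw [C.ip_symm _ Z, C.ip_symm _ Z, C.ip_symm _ Z]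
  linear_combination (norm := module) -h

/-- The first Bianchi identity for a connection with torsion. -/
theorem bianchi (X Y Z : V) :
    C.curvNab X Y Z + C.curvNab Y Z X + C.curvNab Z X Y =
      C.dtor X Y Z + C.dtor Y Z X + C.dtor Z X Y
        + C.tor (C.tor X Y) Z + C.tor (C.tor Y Z) X + C.tor (C.tor Z X) Y := by
  have h := C.jacobi X Y Z
  -- Expanded in `nab` and `br`, the two sides differ by the Jacobi identity; the remaining facts
  -- only bring the brackets to a common orientation.
  have h3 := C.br_skew (C.nab Y X) Z
  have h5 := C.br_skew (C.nab Z Y) X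
  have h7 := C.br_skew (C.nab X Z) Y
  have h8 := C.br_skew (C.br Y Z) X
  have h9 := C.br_skew (C.br Z X) Y
  have h10 : C.br Y (C.br X Z) = -C.br Y (C.br Z X) := by rw [C.br_skew X Z, map_neg]
  simp only [curvNab, dtor, tor, map_sub, LinearMap.sub_apply]
  linear_combination (norm := module) h - h8 - h9 + h10 - h3 - h5 - h7

/-- Comparison of the two curvatures, without any assumption on types. -/
theorem two_ip_curvLC (X Y Z W : V) : (2 : ℂ) • C.ip (C.curvLC X Y Z) W =
    (2 : ℂ) • C.ip (C.curvNab X Y Z) W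
      + (-C.ip (C.dtor X Y Z) W + C.ip (C.dtor X Z W) Y - C.ip (C.dtor X W Y) Z)
      - (-C.ip (C.dtor Y X Z) W + C.ip (C.dtor Y Z W) X - C.ip (C.dtor Y W X) Z)
      + (2 : ℂ) • C.ip (C.diff (C.tor X Y) Z) W
      - (2 : ℂ) • C.ip (C.diff Y Z) (C.diff X W) + (2 : ℂ) • C.ip (C.diff X Z) (C.diff Y W) := by
  -- Differentiating the Koszul-type formula for S: the terms in which ∇ hits an argument are again
  -- instances of that formula, which leaves ∇τ.
  have key : ∀ A B, (2 : ℂ) • C.ip (C.nab A (C.diff B Z)) W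
      = -C.ip (C.dtor A B Z) W + C.ip (C.dtor A Z W) B - C.ip (C.dtor A W B) Z
        + (2 : ℂ) • C.ip (C.diff (C.nab A B) Z) W + (2 : ℂ) • C.ip (C.diff B (C.nab A Z)) W := by
    intro A B
    have h := congrArg (C.dv A) (two_ip_diff (C := C) B Z W)
    simp only [map_smul, map_add, map_sub, map_neg, dv_ip_tor] at h
    rw [C.nab_metric] at h
    have k1 := two_ip_diff (C := C) (C.nab A B) Z W
    have k2 := two_ip_diff (C := C) B (C.nab A Z) W
    have k3 := two_ip_diff (C := C) B Z (C.nab A W)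
    linear_combination (norm := module) h - k1 - k2 - k3
  -- The expansion of R^L for D = ∇ + S; the bracket is eliminated through [X,Y] = ∇_X Y - ∇_Y X -
  -- τ(X,Y).
  have e : C.curvLC X Y Z = C.curvNab X Y Z + C.nab X (C.diff Y Z) - C.nab Y (C.diff X Z)
      - C.diff (C.nab X Y) Z + C.diff (C.nab Y X) Z + C.diff (C.tor X Y) Z
      - C.diff Y (C.nab X Z) + C.diff X (C.nab Y Z)
      + C.diff X (C.diff Y Z) - C.diff Y (C.diff X Z) := by
    simp only [curvLC, curvNab, diff, tor, map_sub, LinearMap.sub_apply]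
    abel
  have q1 := diff_skew (C := C) X (C.diff Y Z) W
  have q2 := diff_skew (C := C) Y (C.diff X Z) W
  rw [e]
  simp only [map_sub, map_add, LinearMap.sub_apply, LinearMap.add_apply]
  linear_combination (norm := module) key X Y - key Y X + (2 : ℂ) • q1 - (2 : ℂ) • q2

end HermitianCalculus

/-! ### Vanishing by type, and the mixed curvature component -/

namespace HermitianCalculus

variable {V F : Type*} [AddCommGroup V] [Module ℂ V] [AddCommGroup F] [Module ℂ F]
  {C : HermitianCalculus V F} {X Y Z W : V}

theorem Hol.nab (A : V) (hX : C.Hol X) : C.Hol (C.nab A X) := by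
  have h : C.J X = Complex.I • X := hX
  rw [Hol, ← C.nab_J, h, map_smul]

theorem Anti.nab (A : V) (hX : C.Anti X) : C.Anti (C.nab A X) := by
  have h : C.J X = -(Complex.I • X) := hX
  rw [Anti, ← C.nab_J, h, map_neg, map_smul]

theorem tor_hol_anti (hX : C.Hol X) (hY : C.Anti Y) : C.tor X Y = 0 := C.torsion11 X Y hX hY

theorem tor_anti_hol (hX : C.Anti X) (hY : C.Hol Y) : C.tor X Y = 0 := by
  rw [tor_skew, tor_hol_anti hY hX, neg_zero]

theorem dtor_hol_anti (A : V) (hX : C.Hol X) (hY : C.Anti Y) : C.dtor A X Y = 0 := by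
  simp [dtor, tor_hol_anti hX hY, tor_hol_anti (hX.nab A) hY, tor_hol_anti hX (hY.nab A)]

theorem dtor_anti_hol (A : V) (hX : C.Anti X) (hY : C.Hol Y) : C.dtor A X Y = 0 := by
  simp [dtor, tor_anti_hol hX hY, tor_anti_hol (hX.nab A) hY, tor_anti_hol hX (hY.nab A)]

theorem ip_J_left (X Y : V) : C.ip (C.J X) Y = -C.ip X (C.J Y) := by
  rw [← C.ip_J X (C.J Y), C.J_sq, map_neg, neg_neg]

/-- J is an isometry and acts on both factors by √-1, so the product equals its own negative. -/
theorem ip_hol_hol (hX : C.Hol X) (hY : C.Hol Y) : C.ip X Y = 0 := by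
  have h := C.ip_J X Y
  rw [show C.J X = _ from hX, show C.J Y = _ from hY] at h
  simp only [map_smul, LinearMap.smul_apply, smul_smul, Complex.I_mul_I] at h
  linear_combination (norm := module) (-(1 / 2) : ℂ) • h

theorem Hol.curvNab (A B : V) (hX : C.Hol X) : C.Hol (C.curvNab A B X) := by
  have h1 : C.J _ = _ := (hX.nab B).nab A
  have h2 : C.J _ = _ := (hX.nab A).nab B
  have h3 : C.J _ = _ := hX.nab (C.br A B)
  simp only [Hol, HermitianCalculus.curvNab, map_sub, h1, h2, h3, smul_sub]

/-- Comparison of the two curvatures in the components of type `(i, j, k, l̄)`. -/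
theorem two_ip_curvLC_hol (hX : C.Hol X) (hY : C.Anti Y) (hZ : C.Hol Z) (hW : C.Hol W) :
    (2 : ℂ) • C.ip (C.curvLC X Y Z) W = C.ip (C.dtor X Z W) Y
      + C.ip (C.dtor Y X Z) W - C.ip (C.dtor Y Z W) X + C.ip (C.dtor Y W X) Z
      - (2 : ℂ) • C.ip (C.diff Y Z) (C.diff X W)
      + (2 : ℂ) • C.ip (C.diff X Z) (C.diff Y W) := by
  have h0 : C.diff (C.tor X Y) Z = 0 := by simp [tor_hol_anti hX hY, diff]
  rw [two_ip_curvLC, ip_hol_hol (hZ.curvNab X Y) hW, dtor_anti_hol X hY hZ, dtor_hol_anti X hW hY,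
    h0]
  simp only [map_zero, LinearMap.zero_apply]
  module

/-- The component of the first Bianchi identity with three `(1,0)`-vectors and one
`(0,1)`-vector that expresses a derivative of the torsion by the curvature. -/
theorem ip_dtor_anti (hX : C.Hol X) (hY : C.Anti Y) (hZ : C.Hol Z) (hW : C.Hol W) :
    C.ip (C.dtor Y X Z) W = -C.ip (C.curvNab X Z W) Y - C.ip (C.tor (C.tor X Z) Y) W := by
  -- Of the nine Bianchi terms, six vanish by type. The surviving curvature maps Y and is moved onto
  -- W by skewness.
  have h := congrArg (fun A => C.ip A W) (bianchi (C := C) Y X Z)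
  have h1 : C.tor (C.tor Y X) Z = 0 := by rw [tor_anti_hol hY hX]; simp [tor]
  have h2 : C.tor (C.tor Z Y) X = 0 := by rw [tor_hol_anti hZ hY]; simp [tor]
  simp only [map_add, LinearMap.add_apply, h1, h2, dtor_hol_anti X hZ hY, dtor_anti_hol Z hY hX,
    ip_hol_hol (hZ.curvNab Y X) hW, ip_hol_hol (hX.curvNab Z Y) hW, map_zero,
    LinearMap.zero_apply] at h
  rw [curvNab_skew X Z Y W] at h
  linear_combination (norm := module) -h

/-! ### The fundamental form and the nearly Kähler condition -/

/-- The exterior derivative of the fundamental form, by the invariant formula. -/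
def dOmega (C : HermitianCalculus V F) (X Y Z : V) : F :=
  C.dv X (C.ip (C.J Y) Z) - C.dv Y (C.ip (C.J X) Z) + C.dv Z (C.ip (C.J X) Y)
    - C.ip (C.J (C.br X Y)) Z + C.ip (C.J (C.br X Z)) Y - C.ip (C.J (C.br Y Z)) X

/-- Since ω is ∇-parallel, its exterior derivative involves only the torsion of ∇. -/
theorem dOmega_eq (X Y Z : V) : C.dOmega X Y Z =
    C.ip (C.J (C.tor X Y)) Z - C.ip (C.J (C.tor X Z)) Y + C.ip (C.J (C.tor Y Z)) X := by
  have s : ∀ A B, C.ip (C.J A) B = -C.ip (C.J B) A := fun A B => by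
    rw [ip_J_left, C.ip_symm]
  simp only [dOmega, C.nab_metric, C.nab_J, tor, map_sub, LinearMap.sub_apply]
  have h1 := s Y (C.nab X Z)
  have h2 := s X (C.nab Y Z)
  have h3 := s X (C.nab Z Y)
  linear_combination (norm := module) h1 - h2 + h3

theorem dOmega_hol_anti_anti (hX : C.Hol X) (hY : C.Anti Y) (hZ : C.Anti Z) :
    C.dOmega X Y Z = -(Complex.I • C.ip (C.tor Y Z) X) := by
  rw [dOmega_eq, tor_hol_anti hX hY, tor_hol_anti hX hZ, ip_J_left (C.tor Y Z),
    show C.J X = _ from hX]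
  simp

/-- The polarized nearly Kähler condition. -/
def NearlyKahler (C : HermitianCalculus V F) : Prop :=
  ∀ X Y, C.lc X (C.J Y) - C.J (C.lc X Y) + (C.lc Y (C.J X) - C.J (C.lc Y X)) = 0

/-- As ∇J = 0, the derivative DJ is the commutator of S with J. This turns the nearly Kähler
condition into one on the torsion. -/
theorem lc_J_sub (X Y : V) :
    C.lc X (C.J Y) - C.J (C.lc X Y) = C.diff X (C.J Y) - C.J (C.diff X Y) := by
  simp only [diff, map_sub, C.nab_J]; abel

/-- On (1,0)-fields the commutator with J doubles, so the condition says that S(X,Y) + S(Y,X) pairs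
to zero with (1,0)-fields. By `two_ip_diff` this is the stated skewness. -/
theorem NearlyKahler.tor_hol (h : C.NearlyKahler) (hX : C.Hol X) (hY : C.Hol Y) (hW : C.Hol W) :
    C.ip (C.tor Y W) X = -C.ip (C.tor X W) Y := by
  have h0 := congrArg (fun A => C.ip A W) (h X Y)
  simp only [lc_J_sub, map_add, map_sub, LinearMap.add_apply, LinearMap.sub_apply, ip_J_left] at h0
  rw [show C.J X = _ from hX, show C.J Y = _ from hY, show C.J W = _ from hW] at h0
  have hs : ∀ A B, C.diff A (Complex.I • B) = Complex.I • C.diff A B := by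
    intro A B; simp only [diff, map_smul, smul_sub]
  simp only [hs, map_smul, LinearMap.smul_apply, map_zero, LinearMap.zero_apply] at h0
  have h1 := congrArg (fun f => (-Complex.I) • f) h0
  simp only [smul_add, smul_sub, smul_neg, smul_smul, neg_mul, Complex.I_mul_I] at h1
  have k1 := two_ip_diff (C := C) X Y W
  have k2 := two_ip_diff (C := C) Y X W
  have t1 := congrArg (fun A => C.ip A W) (tor_skew (C := C) X Y)
  have t2 := congrArg (fun A => C.ip A Y) (tor_skew (C := C) W X)
  have t3 := congrArg (fun A => C.ip A X) (tor_skew (C := C) W Y)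
  simp only [map_neg, LinearMap.neg_apply] at t1 t2 t3
  linear_combination (norm := module) ((1 / 2 : ℂ)) • (h1 - k1 - k2 + t1 + t2 + t3)

/-- For mixed types the S(Y,X) terms cancel and the condition reduces to ⟨S(X,Y), W⟩ = 0, where only
this torsion term survives in `two_ip_diff`. Thus nearly Kähler implies quasi Kähler. -/
theorem NearlyKahler.tor_anti_anti (h : C.NearlyKahler) (hX : C.Hol X) (hY : C.Anti Y)
    (hW : C.Anti W) : C.ip (C.tor Y W) X = 0 := by
  have h0 := congrArg (fun A => C.ip A W) (h X Y)
  simp only [lc_J_sub, map_add, map_sub, LinearMap.add_apply, LinearMap.sub_apply, ip_J_left] at h0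
  rw [show C.J X = _ from hX, show C.J Y = _ from hY, show C.J W = _ from hW] at h0
  have hs : ∀ A B, C.diff A (Complex.I • B) = Complex.I • C.diff A B := by
    intro A B; simp only [diff, map_smul, smul_sub]
  have hn : ∀ A B, C.diff A (-B) = -C.diff A B := by
    intro A B; simp only [diff, map_neg]; abel
  simp only [hs, hn, map_smul, map_neg, LinearMap.smul_apply, LinearMap.neg_apply, map_zero,
    LinearMap.zero_apply] at h0
  have h1 := congrArg (fun f => Complex.I • f) h0
  simp only [smul_add, smul_sub, smul_neg, smul_smul, Complex.I_mul_I] at h1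
  have k1 := two_ip_diff (C := C) X Y W
  rw [tor_hol_anti hX hY, tor_anti_hol hW hX] at k1
  simp only [map_zero, LinearMap.zero_apply] at k1
  linear_combination (norm := module) h1 - k1

theorem ip_dtor_eq (W X Y Z : V) : C.ip (C.dtor W X Y) Z = C.dv W (C.ip (C.tor X Y) Z)
    - C.ip (C.tor (C.nab W X) Y) Z - C.ip (C.tor X (C.nab W Y)) Z
    - C.ip (C.tor X Y) (C.nab W Z) := by
  rw [dv_ip_tor]; abel

/-- The skewness of τ holds for all (1,0)-fields and ∇ preserves their type, so it can be
differentiated. -/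
theorem NearlyKahler.dtor_hol (h : C.NearlyKahler) (A : V) (hX : C.Hol X) (hY : C.Hol Y)
    (hW : C.Hol W) : C.ip (C.dtor A Y W) X = -C.ip (C.dtor A X W) Y := by
  rw [ip_dtor_eq, ip_dtor_eq, h.tor_hol hX hY hW, h.tor_hol hX (hY.nab A) hW,
    h.tor_hol hX hY (hW.nab A), h.tor_hol (hX.nab A) hY hW, map_neg]
  abel

/-- If the torsion maps `(1,0)`-vectors to `(0,1)`-vectors, so does its covariant derivative. -/
theorem ip_dtor_eq_zero (h : ∀ X Y Z, C.Hol X → C.Hol Y → C.Anti Z → C.ip (C.tor X Y) Z = 0)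
    (A : V) (hX : C.Hol X) (hY : C.Hol Y) (hZ : C.Anti Z) : C.ip (C.dtor A X Y) Z = 0 := by
  rw [ip_dtor_eq, h _ _ _ hX hY hZ, h _ _ _ (hX.nab A) hY hZ, h _ _ _ hX (hY.nab A) hZ,
    h _ _ _ hX hY (hZ.nab A)]
  simp

end HermitianCalculus

/-! ### Smooth real fields and functions on an open set -/

variable {E : Type*} [NormedAddCommGroup E] [NormedSpace ℝ E] [FiniteDimensional ℝ E]
  [CompleteSpace E]
  {H : Type*} [TopologicalSpace H] {I : ModelWithCorners ℝ E H}
  {M : Type*} [TopologicalSpace M] [ChartedSpace H M] [IsManifold I ∞ M]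

/-- The vector fields that are smooth on `U` and vanish outside `U`. -/
def SField (I : ModelWithCorners ℝ E H) [IsManifold I ∞ M] (U : Opens M) :
    Submodule ℝ (∀ x : M, TangentSpace I x) where
  carrier := {X | ContMDiffOn I I.tangent ∞ (fun y => (⟨y, X y⟩ : TangentBundle I M)) U ∧
    ∀ x ∉ U, X x = 0}
  add_mem' := fun hX hY => ⟨hX.1.add_section hY.1, fun x hx => by simp [hX.2 x hx, hY.2 x hx]⟩
  zero_mem' := ⟨(Bundle.contMDiff_zeroSection ℝ (TangentSpace I : M → Type _)).contMDiffOn,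
    fun _ _ => rfl⟩
  smul_mem' := fun c X hX => ⟨hX.1.const_smul_section (a := c), fun x hx => by simp [hX.2 x hx]⟩

/-- The functions that are smooth on `U` and vanish outside `U`. -/
def SFun (I : ModelWithCorners ℝ E H) (U : Opens M) : Submodule ℝ (M → ℝ) where
  carrier := {f | ContMDiffOn I 𝓘(ℝ, ℝ) ∞ f U ∧ ∀ x ∉ U, f x = 0}
  add_mem' := fun hX hY => ⟨hX.1.add hY.1, fun x hx => by simp [hX.2 x hx, hY.2 x hx]⟩
  zero_mem' := ⟨contMDiffOn_const, fun _ _ => rfl⟩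
  smul_mem' := fun c X hX => ⟨(contMDiffOn_const (c := c)).mul hX.1, fun x hx => by simp [hX.2 x hx]⟩

variable {U : Opens M}

theorem SField.contMDiffAt (X : SField I U) {x : M} (hx : x ∈ U) :
    ContMDiffAt I I.tangent ∞ (fun y => (⟨y, X.1 y⟩ : TangentBundle I M)) x :=
  X.2.1.contMDiffAt (U.isOpen.mem_nhds hx)

theorem SField.mdifferentiableAt (X : SField I U) {x : M} (hx : x ∈ U) :
    MDifferentiableAt I I.tangent (fun y => (⟨y, X.1 y⟩ : TangentBundle I M)) x :=
  (SField.contMDiffAt X hx).mdifferentiableAt (by simp)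

theorem SFun.contMDiffAt (f : SFun I U) {x : M} (hx : x ∈ U) :
    ContMDiffAt I 𝓘(ℝ, ℝ) ∞ f.1 x :=
  f.2.1.contMDiffAt (U.isOpen.mem_nhds hx)

theorem SFun.mdifferentiableAt (f : SFun I U) {x : M} (hx : x ∈ U) :
    MDifferentiableAt I 𝓘(ℝ, ℝ) f.1 x :=
  (SFun.contMDiffAt f hx).mdifferentiableAt (by simp)

@[simp] theorem SField.add_apply (X Y : SField I U) (x : M) : (X + Y).1 x = X.1 x + Y.1 x := rfl
@[simp] theorem SField.neg_apply (X : SField I U) (x : M) : (-X).1 x = -X.1 x := rfl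
@[simp] theorem SField.sub_apply (X Y : SField I U) (x : M) : (X - Y).1 x = X.1 x - Y.1 x := rfl
@[simp] theorem SField.smul_apply (c : ℝ) (X : SField I U) (x : M) :
    (c • X).1 x = c • X.1 x := rfl
@[simp] theorem SField.zero_apply (x : M) : (0 : SField I U).1 x = 0 := rfl
@[simp] theorem SFun.add_apply (X Y : SFun I U) (x : M) : (X + Y).1 x = X.1 x + Y.1 x := rfl
@[simp] theorem SFun.neg_apply (X : SFun I U) (x : M) : (-X).1 x = -X.1 x := rfl
@[simp] theorem SFun.sub_apply (X Y : SFun I U) (x : M) : (X - Y).1 x = X.1 x - Y.1 x := rfl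
@[simp] theorem SFun.smul_apply (c : ℝ) (X : SFun I U) (x : M) :
    (c • X).1 x = c • X.1 x := rfl
@[simp] theorem SFun.zero_apply (x : M) : (0 : SFun I U).1 x = 0 := rfl

/-- Extension by zero makes equality on U genuine equality, so that identities valid on U become
equations in a vector space. -/
theorem SField.ext_on {X Y : SField I U} (h : ∀ x ∈ U, X.1 x = Y.1 x) : X = Y := by
  ext x
  by_cases hx : x ∈ U
  · rw [h x hx]
  · rw [X.2.2 x hx, Y.2.2 x hx]

theorem SFun.ext_on {X Y : SFun I U} (h : ∀ x ∈ U, X.1 x = Y.1 x) : X = Y := by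
  ext x
  by_cases hx : x ∈ U
  · rw [h x hx]
  · rw [X.2.2 x hx, Y.2.2 x hx]

open Classical in
/-- The restriction to `U`, extended by zero, of a field that is smooth on `U`. -/
def SField.cut (X : ∀ x : M, TangentSpace I x)
    (hX : ContMDiffOn I I.tangent ∞ (fun y => (⟨y, X y⟩ : TangentBundle I M)) U) : SField I U :=
  ⟨fun x => if x ∈ U then X x else 0, hX.congr fun x hx => by simp [show x ∈ U from hx],
    fun x hx => by simp [hx]⟩

theorem SField.cut_apply {X : ∀ x : M, TangentSpace I x}
    (hX : ContMDiffOn I I.tangent ∞ (fun y => (⟨y, X y⟩ : TangentBundle I M)) U) {x : M}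
    (hx : x ∈ U) : (SField.cut X hX).1 x = X x := by simp [cut, hx]

open Classical in
/-- The restriction to `U`, extended by zero, of a function that is smooth on `U`. -/
def SFun.cut (f : M → ℝ) (hf : ContMDiffOn I 𝓘(ℝ, ℝ) ∞ f U) : SFun I U :=
  ⟨fun x => if x ∈ U then f x else 0, hf.congr fun x hx => by simp [show x ∈ U from hx],
    fun x hx => by simp [hx]⟩

theorem SFun.cut_apply {f : M → ℝ} (hf : ContMDiffOn I 𝓘(ℝ, ℝ) ∞ f U) {x : M}
    (hx : x ∈ U) : (SFun.cut f hf).1 x = f x := by simp [cut, hx]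

/-! ### The geometric operations on smooth real fields -/

/-- A smooth connection as a bilinear operation on smooth fields. -/
def covOp (cov : CovariantDerivative I E (TangentSpace I : M → Type _))
    (hcov : IsSmoothConnection cov) (U : Opens M) :
    SField I U →ₗ[ℝ] SField I U →ₗ[ℝ] SField I U :=
  LinearMap.mk₂ ℝ
    (fun X Y => SField.cut (fun x => cov Y.1 x (X.1 x))
      (((hcov U U.isOpen).contMDiff Y.2.1).clm_bundle_apply X.2.1))
    (fun X X' Y => SField.ext_on fun x hx => by simp [SField.cut_apply _ hx])
    (fun c X Y => SField.ext_on fun x hx => by simp [SField.cut_apply _ hx])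
    (fun X Y Y' => SField.ext_on fun x hx => by
      simp only [SField.cut_apply _ hx, SField.add_apply]
      exact congrArg (· (X.1 x)) (cov.isCovariantDerivativeOnUniv.add
        (SField.mdifferentiableAt Y hx) (SField.mdifferentiableAt Y' hx)))
    (fun c X Y => SField.ext_on fun x hx => by
      simp only [SField.cut_apply _ hx, SField.smul_apply]
      exact congrArg (· (X.1 x)) (cov.isCovariantDerivativeOnUniv.smul_const c
        (SField.mdifferentiableAt Y hx)))

theorem covOp_apply (cov : CovariantDerivative I E (TangentSpace I : M → Type _))
    (hcov : IsSmoothConnection cov) (X Y : SField I U) {x : M} (hx : x ∈ U) :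
    (covOp cov hcov U X Y).1 x = cov Y.1 x (X.1 x) :=
  SField.cut_apply (((hcov U U.isOpen).contMDiff Y.2.1).clm_bundle_apply X.2.1) hx

theorem isManifold_minSmoothness (k : ℕ) : IsManifold I (minSmoothness ℝ k) M := by
  rw [minSmoothness_of_isRCLikeNormedField]
  exact IsManifold.of_le (n := ∞) (by exact_mod_cast le_top)

theorem contMDiffOn_mlieBracket (X Y : SField I U) : ContMDiffOn I I.tangent ∞
    (fun y => (⟨y, mlieBracket I X.1 Y.1 y⟩ : TangentBundle I M)) U := fun x hx => by
  have : IsManifold I (minSmoothness ℝ 2) M := isManifold_minSmoothness 2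
  -- The bracket costs one derivative, harmless since ∞ + 1 = ∞.
  have : IsManifold I ((⊤ : ℕ∞) + 1) M := inferInstanceAs (IsManifold I ∞ M)
  exact (ContMDiffAt.mlieBracket_vectorField (m := ⊤) (n := ⊤) (SField.contMDiffAt X hx)
    (SField.contMDiffAt Y hx) (by simp)).contMDiffWithinAt

/-- The Lie bracket as a bilinear operation on smooth fields. -/
def brOp (I : ModelWithCorners ℝ E H) [IsManifold I ∞ M] (U : Opens M) :
    SField I U →ₗ[ℝ] SField I U →ₗ[ℝ] SField I U :=
  LinearMap.mk₂ ℝ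
    (fun X Y => SField.cut (mlieBracket I X.1 Y.1) (contMDiffOn_mlieBracket X Y))
    (fun X X' Y => SField.ext_on fun x hx => by
      simp only [SField.cut_apply _ hx, SField.add_apply]
      exact mlieBracket_add_left (SField.mdifferentiableAt X hx) (SField.mdifferentiableAt X' hx))
    (fun c X Y => SField.ext_on fun x hx => by
      simp only [SField.cut_apply _ hx, SField.smul_apply]
      exact mlieBracket_const_smul_left (SField.mdifferentiableAt X hx))
    (fun X Y Y' => SField.ext_on fun x hx => by
      simp only [SField.cut_apply _ hx, SField.add_apply]
      exact mlieBracket_add_right (SField.mdifferentiableAt Y hx) (SField.mdifferentiableAt Y' hx))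
    (fun c X Y => SField.ext_on fun x hx => by
      simp only [SField.cut_apply _ hx, SField.smul_apply]
      exact mlieBracket_const_smul_right (SField.mdifferentiableAt Y hx))

theorem brOp_apply (X Y : SField I U) {x : M} (hx : x ∈ U) :
    (brOp I U X Y).1 x = mlieBracket I X.1 Y.1 x :=
  SField.cut_apply (contMDiffOn_mlieBracket X Y) hx

theorem contMDiffOn_inner (g : ContMDiffRiemannianMetric I ∞ E (fun x : M => TangentSpace I x))
    (X Y : SField I U) :
    ContMDiffOn I 𝓘(ℝ, ℝ) ∞ (fun x => g.inner x (X.1 x) (Y.1 x)) U := by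
  have h : ContMDiffOn I (I.prod 𝓘(ℝ, ℝ)) ∞
      (fun x => TotalSpace.mk' ℝ (E := Bundle.Trivial M ℝ) x (g.inner x (X.1 x) (Y.1 x))) U :=
    g.contMDiff.contMDiffOn.clm_bundle_apply₂ X.2.1 Y.2.1
  intro x hx
  have h1 := h x hx
  simp only [contMDiffWithinAt_totalSpace] at h1
  exact h1.2

/-- The Riemannian metric as a bilinear operation on smooth fields. -/
def ipOp (g : ContMDiffRiemannianMetric I ∞ E (fun x : M => TangentSpace I x)) (U : Opens M) :
    SField I U →ₗ[ℝ] SField I U →ₗ[ℝ] SFun I U :=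
  LinearMap.mk₂ ℝ
    (fun X Y => SFun.cut (fun x => g.inner x (X.1 x) (Y.1 x)) (contMDiffOn_inner g X Y))
    (fun X X' Y => SFun.ext_on fun x hx => by simp [SFun.cut_apply _ hx])
    (fun c X Y => SFun.ext_on fun x hx => by simp [SFun.cut_apply _ hx])
    (fun X Y Y' => SFun.ext_on fun x hx => by simp [SFun.cut_apply _ hx])
    (fun c X Y => SFun.ext_on fun x hx => by simp [SFun.cut_apply _ hx])

theorem ipOp_apply (g : ContMDiffRiemannianMetric I ∞ E (fun x : M => TangentSpace I x))
    (X Y : SField I U) {x : M} (hx : x ∈ U) :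
    (ipOp g U X Y).1 x = g.inner x (X.1 x) (Y.1 x) :=
  SFun.cut_apply (contMDiffOn_inner g X Y) hx

/-- The derivative Xf is the fibre component of the tangent map of f composed with the section X. -/
theorem contMDiffOn_mvfderiv (X : SField I U) (f : SFun I U) :
    ContMDiffOn I 𝓘(ℝ, ℝ) ∞ (fun x => mvfderiv I f.1 x (X.1 x)) U := by
  have h := f.2.1.contMDiffOn_tangentMapWithin (m := ∞) (by simp) U.isOpen.uniqueMDiffOn
  have h1 : ContMDiffOn I 𝓘(ℝ, ℝ).tangent ∞
      (fun x => tangentMapWithin I 𝓘(ℝ, ℝ) f.1 U ⟨x, X.1 x⟩) U :=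
    h.comp X.2.1 (fun x hx => hx)
  have h2 := (contMDiff_snd_tangentBundle_modelSpace ℝ 𝓘(ℝ, ℝ) (n := ∞)).comp_contMDiffOn h1
  refine h2.congr fun x hx => ?_
  simp only [Function.comp, tangentMapWithin, mfderivWithin_of_isOpen U.isOpen hx]
  rfl

/-- The derivative of functions along fields. -/
def dvOp (I : ModelWithCorners ℝ E H) [IsManifold I ∞ M] (U : Opens M) :
    SField I U →ₗ[ℝ] SFun I U →ₗ[ℝ] SFun I U :=
  LinearMap.mk₂ ℝ
    (fun X f => SFun.cut (fun x => mvfderiv I f.1 x (X.1 x)) (contMDiffOn_mvfderiv X f))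
    (fun X X' Y => SFun.ext_on fun x hx => by simp [SFun.cut_apply _ hx])
    (fun c X Y => SFun.ext_on fun x hx => by simp [SFun.cut_apply _ hx])
    (fun X f f' => SFun.ext_on fun x hx => by
      simp only [SFun.cut_apply _ hx, SFun.add_apply]
      exact congrArg (· (X.1 x)) (mvfderiv_add (SFun.mdifferentiableAt f hx) (SFun.mdifferentiableAt f' hx)))
    (fun c X f => SFun.ext_on fun x hx => by
      simp only [SFun.cut_apply _ hx, SFun.smul_apply]
      have h := mvfderiv_smul (I := I) (x := x) (a := fun _ => c) mdifferentiableAt_const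
        (SFun.mdifferentiableAt f hx)
      rw [mvfderiv_const] at h
      simpa using! congrArg (· (X.1 x)) h)

theorem dvOp_apply (X : SField I U) (f : SFun I U) {x : M} (hx : x ∈ U) :
    (dvOp I U X f).1 x = mvfderiv I f.1 x (X.1 x) :=
  SFun.cut_apply (contMDiffOn_mvfderiv X f) hx

/-- An almost complex structure as an operator on smooth fields. -/
def jOp (J : AlmostComplexStructure I M) (U : Opens M) : SField I U →ₗ[ℝ] SField I U where
  toFun X := ⟨fun x => J x (X.1 x), J.smooth.contMDiffOn.clm_bundle_apply X.2.1,
    fun x hx => by simp [X.2.2 x hx]⟩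
  map_add' X Y := SField.ext_on fun x hx => by simp
  map_smul' c X := SField.ext_on fun x hx => by simp

@[simp] theorem jOp_apply (J : AlmostComplexStructure I M) (X : SField I U) (x : M) :
    (jOp J U X).1 x = J x (X.1 x) := rfl

theorem ipOp_symm (g : ContMDiffRiemannianMetric I ∞ E (fun x : M => TangentSpace I x))
    (X Y : SField I U) : ipOp g U X Y = ipOp g U Y X :=
  SFun.ext_on fun x hx => by rw [ipOp_apply g X Y hx, ipOp_apply g Y X hx, g.symm]

theorem brOp_skew (X Y : SField I U) : brOp I U X Y = -brOp I U Y X :=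
  SField.ext_on fun x hx => by
    rw [brOp_apply X Y hx, SField.neg_apply, brOp_apply Y X hx, mlieBracket_swap_apply]

theorem mlieBracket_congr_on {X X' Y Y' : ∀ x : M, TangentSpace I x}
    (h : ∀ x ∈ U, X x = X' x) (h' : ∀ x ∈ U, Y x = Y' x) {x : M} (hx : x ∈ U) :
    mlieBracket I X Y x = mlieBracket I X' Y' x :=
  Filter.EventuallyEq.mlieBracket_vectorField_eq
    (Filter.eventuallyEq_of_mem (U.isOpen.mem_nhds hx) h)
    (Filter.eventuallyEq_of_mem (U.isOpen.mem_nhds hx) h')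

theorem brOp_jacobi (X Y Z : SField I U) :
    brOp I U X (brOp I U Y Z) = brOp I U (brOp I U X Y) Z + brOp I U Y (brOp I U X Z) :=
  SField.ext_on fun x hx => by
    have : IsManifold I (minSmoothness ℝ 3) M := isManifold_minSmoothness 3
    have h2 : minSmoothness ℝ 2 ≤ ∞ := by
      rw [minSmoothness_of_isRCLikeNormedField]; exact WithTop.coe_le_coe.2 le_top
    have h := leibniz_identity_mlieBracket_apply (I := I) (x := x)
      ((SField.contMDiffAt X hx).of_le h2) ((SField.contMDiffAt Y hx).of_le h2)
      ((SField.contMDiffAt Z hx).of_le h2)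
    rw [SField.add_apply, brOp_apply _ _ hx, brOp_apply _ _ hx, brOp_apply _ _ hx,
      mlieBracket_congr_on (fun _ _ => rfl) (fun y hy => brOp_apply Y Z hy) hx,
      mlieBracket_congr_on (fun y hy => brOp_apply X Y hy) (fun _ _ => rfl) hx,
      mlieBracket_congr_on (fun _ _ => rfl) (fun y hy => brOp_apply X Z hy) hx, h]

/-- The product of a smooth function and a smooth field. -/
def fmul (f : SFun I U) (X : SField I U) : SField I U :=
  ⟨fun x => f.1 x • X.1 x, f.2.1.smul_section X.2.1, fun x hx => by simp [X.2.2 x hx]⟩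

theorem brOp_fmul (f : SFun I U) (X Y : SField I U) :
    brOp I U X (fmul f Y) = fmul (dvOp I U X f) Y + fmul f (brOp I U X Y) :=
  SField.ext_on fun x hx => by
    rw [SField.add_apply, brOp_apply _ _ hx]
    refine (mlieBracket_smul_right (SFun.mdifferentiableAt f hx)
      (SField.mdifferentiableAt Y hx)).trans ?_
    simp only [fmul, dvOp_apply X f hx, brOp_apply X Y hx]

/-- This follows from the Jacobi identity. By the Leibniz rule, Jacobi for X, Y, fV minus f times
Jacobi for X, Y, V is (XYf - YXf - [X,Y]f) V = 0. -/
theorem dvOp_brOp (X Y : SField I U) (f : SFun I U) :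
    dvOp I U (brOp I U X Y) f = dvOp I U X (dvOp I U Y f) - dvOp I U Y (dvOp I U X f) := by
  have key : ∀ V : SField I U, ∀ x, (dvOp I U X (dvOp I U Y f) - dvOp I U Y (dvOp I U X f)
      - dvOp I U (brOp I U X Y) f).1 x • V.1 x = 0 := by
    intro V x
    have h := brOp_jacobi X Y (fmul f V)
    simp only [brOp_fmul, map_add] at h
    have h' := congrArg (fun W : SField I U => W.1 x) h
    have hj := congrArg (fun W : SField I U => f.1 x • W.1 x) (brOp_jacobi X Y V)
    simp only [SField.add_apply, fmul] at h' hj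
    simp only [SFun.sub_apply]
    linear_combination (norm := module) h' - hj
  refine SFun.ext_on fun x hx => ?_
  rw [← sub_eq_zero, ← neg_eq_zero]
  -- A field V nonzero at x is needed to cancel it: X or Y serves unless both vanish at x, and then
  -- [X,Y] vanishes there too and every term is zero.
  by_cases hX : X.1 x = 0
  · by_cases hY : Y.1 x = 0
    · have hb : mlieBracket I X.1 Y.1 x = 0 := by
        rw [← mlieBracketWithin_univ]; exact mlieBracketWithin_eq_zero_of_eq_zero hX hY
      rw [SFun.sub_apply, dvOp_apply _ _ hx, dvOp_apply _ _ hx, dvOp_apply _ _ hx,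
        brOp_apply _ _ hx, hb, hX, hY]
      simp
    · have h := (smul_eq_zero.1 (key Y x)).resolve_right hY
      rw [← h]; simp
  · have h := (smul_eq_zero.1 (key X x)).resolve_right hX
    rw [← h]; simp

theorem mvfderiv_congr_on {f f' : M → ℝ} (h : ∀ x ∈ U, f x = f' x) {x : M} (hx : x ∈ U) :
    mvfderiv I f x = mvfderiv I f' x := by
  have h0 : f =ᶠ[nhds x] f' := Filter.eventuallyEq_of_mem (U.isOpen.mem_nhds hx) h
  ext v
  simp only [mvfderiv, h0.mfderiv_eq]
  rfl

theorem dvOp_ipOp {g : ContMDiffRiemannianMetric I ∞ E (fun x : M => TangentSpace I x)}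
    {cov : CovariantDerivative I E (TangentSpace I : M → Type _)} (hcov : IsSmoothConnection cov)
    (hg : IsMetric g cov) (X Y Z : SField I U) :
    dvOp I U X (ipOp g U Y Z)
      = ipOp g U (covOp cov hcov U X Y) Z + ipOp g U Y (covOp cov hcov U X Z) :=
  SFun.ext_on fun x hx => by
    rw [SFun.add_apply, dvOp_apply _ _ hx, ipOp_apply _ _ _ hx, ipOp_apply _ _ _ hx,
      covOp_apply _ _ _ _ hx, covOp_apply _ _ _ _ hx,
      mvfderiv_congr_on (fun y hy => ipOp_apply g Y Z hy) hx]
    exact hg x Y.1 Z.1 (SField.mdifferentiableAt Y hx) (SField.mdifferentiableAt Z hx) (X.1 x)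

theorem torsion_covOp {cov : CovariantDerivative I E (TangentSpace I : M → Type _)}
    (hcov : IsSmoothConnection cov) (X Y : SField I U) {x : M} (hx : x ∈ U) :
    (covOp cov hcov U X Y - covOp cov hcov U Y X - brOp I U X Y).1 x
      = cov.torsion x (X.1 x) (Y.1 x) := by
  rw [SField.sub_apply, SField.sub_apply, covOp_apply _ _ _ _ hx, covOp_apply _ _ _ _ hx,
    brOp_apply _ _ hx, cov.torsion_apply (SField.mdifferentiableAt X hx)
      (SField.mdifferentiableAt Y hx)]

theorem jOp_covOp {g : ContMDiffRiemannianMetric I ∞ E (fun x : M => TangentSpace I x)}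
    {J : AlmostComplexStructure I M}
    {cov : CovariantDerivative I E (TangentSpace I : M → Type _)} (hcov : IsCanonical g J cov)
    (X Y : SField I U) :
    covOp cov hcov.smooth U X (jOp J U Y) = jOp J U (covOp cov hcov.smooth U X Y) :=
  SField.ext_on fun x hx => by
    rw [jOp_apply, covOp_apply _ _ _ _ hx, covOp_apply _ _ _ _ hx]
    exact sub_eq_zero.1 (hcov.parallel x Y.1 (SField.mdifferentiableAt Y hx) (X.1 x))

theorem jOp_sq (J : AlmostComplexStructure I M) (X : SField I U) : jOp J U (jOp J U X) = -X :=
  SField.ext_on fun x _ => J.sq x (X.1 x)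

theorem ipOp_jOp {g : ContMDiffRiemannianMetric I ∞ E (fun x : M => TangentSpace I x)}
    {J : AlmostComplexStructure I M} (hJ : IsAlmostHermitian g J) (X Y : SField I U) :
    ipOp g U (jOp J U X) (jOp J U Y) = ipOp g U X Y :=
  SFun.ext_on fun x hx => by
    rw [ipOp_apply g _ _ hx, ipOp_apply g _ _ hx]; exact hJ x _ _

/-- Polarization of (D_X J)X = 0 at X + Y. -/
theorem nearlyKahler_covOp {J : AlmostComplexStructure I M}
    {D : CovariantDerivative I E (TangentSpace I : M → Type _)} (hD : IsSmoothConnection D)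
    (h : IsNearlyKahler J D) (X Y : SField I U) :
    covOp D hD U X (jOp J U Y) - jOp J U (covOp D hD U X Y)
      + (covOp D hD U Y (jOp J U X) - jOp J U (covOp D hD U Y X)) = 0 := by
  have key : ∀ Z : SField I U, covOp D hD U Z (jOp J U Z) - jOp J U (covOp D hD U Z Z) = 0 :=
    fun Z => SField.ext_on fun x hx => by
      rw [SField.sub_apply, jOp_apply, covOp_apply _ _ _ _ hx, covOp_apply _ _ _ _ hx]
      exact h x Z.1 (SField.mdifferentiableAt Z hx)
  have h0 := key (X + Y)
  simp only [map_add, LinearMap.add_apply] at h0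
  linear_combination (norm := module) h0 - key X - key Y

/-! ### Complexification of the operations -/

namespace Cplx

variable {V W Z : Type*} [AddCommGroup V] [Module ℝ V] [AddCommGroup W] [Module ℝ W]
  [AddCommGroup Z] [Module ℝ Z]

/-- The complex bilinear extension of a real bilinear map. -/
def bil (B : V →ₗ[ℝ] W →ₗ[ℝ] Z) : Cplx V →ₗ[ℂ] Cplx W →ₗ[ℂ] Cplx Z :=
  LinearMap.mk₂ ℂ (fun v w => ⟨B v.re w.re - B v.im w.im, B v.re w.im + B v.im w.re⟩)
    (fun v v' w => by apply Cplx.ext <;> simp <;> abel)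
    (fun c v w => by apply Cplx.ext <;> simp <;> module)
    (fun v w w' => by apply Cplx.ext <;> simp <;> abel)
    (fun c v w => by apply Cplx.ext <;> simp <;> module)

@[simp] theorem bil_re (B : V →ₗ[ℝ] W →ₗ[ℝ] Z) (v : Cplx V) (w : Cplx W) :
    (bil B v w).re = B v.re w.re - B v.im w.im := rfl
@[simp] theorem bil_im (B : V →ₗ[ℝ] W →ₗ[ℝ] Z) (v : Cplx V) (w : Cplx W) :
    (bil B v w).im = B v.re w.im + B v.im w.re := rfl

theorem bil_conj (B : V →ₗ[ℝ] W →ₗ[ℝ] Z) (v : Cplx V) (w : Cplx W) :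
    bil B v.conj w.conj = (bil B v w).conj := by
  apply Cplx.ext <;> simp [conj]; abel

/-- The complex linear extension of a real linear map. -/
def lin (f : V →ₗ[ℝ] W) : Cplx V →ₗ[ℂ] Cplx W where
  toFun := map f
  map_add' v w := by apply Cplx.ext <;> simp [map]
  map_smul' c v := by apply Cplx.ext <;> simp [map]

@[simp] theorem lin_re (f : V →ₗ[ℝ] W) (v : Cplx V) : (lin f v).re = f v.re := rfl
@[simp] theorem lin_im (f : V →ₗ[ℝ] W) (v : Cplx V) : (lin f v).im = f v.im := rfl

end Cplx

/-- A complex smooth field as a section of the complexified tangent bundle. -/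
def toField (X : Cplx (SField I U)) : CField I M := fun x => ⟨X.re.1 x, X.im.1 x⟩

/-- The value at `x` of a complex function. -/
def evalAt (x : M) : Cplx (SFun I U) →ₗ[ℂ] ℂ where
  toFun f := ⟨f.re.1 x, f.im.1 x⟩
  map_add' f f' := by apply Complex.ext <;> simp
  map_smul' c f := by apply Complex.ext <;> simp

@[simp] theorem evalAt_re (x : M) (f : Cplx (SFun I U)) : (evalAt x f).re = f.re.1 x := rfl
@[simp] theorem evalAt_im (x : M) (f : Cplx (SFun I U)) : (evalAt x f).im = f.im.1 x := rfl

theorem eq_of_toField {X Y : Cplx (SField I U)} (h : ∀ x ∈ U, toField X x = toField Y x) :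
    X = Y :=
  Cplx.ext (SField.ext_on fun x hx => congrArg Cplx.re (h x hx))
    (SField.ext_on fun x hx => congrArg Cplx.im (h x hx))

theorem eq_of_evalAt {f f' : Cplx (SFun I U)} (h : ∀ x ∈ U, evalAt x f = evalAt x f') :
    f = f' :=
  Cplx.ext (SFun.ext_on fun x hx => congrArg Complex.re (h x hx))
    (SFun.ext_on fun x hx => congrArg Complex.im (h x hx))

theorem evalAt_ip (g : ContMDiffRiemannianMetric I ∞ E (fun x : M => TangentSpace I x))
    (X Y : Cplx (SField I U)) {x : M} (hx : x ∈ U) :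
    evalAt x (Cplx.bil (ipOp g U) X Y) = cinner g (toField X x) (toField Y x) := by
  apply Complex.ext <;> simp [cinner, toField, ipOp_apply g _ _ hx]

theorem toField_sub (X Y : Cplx (SField I U)) (x : M) :
    toField (X - Y) x = toField X x - toField Y x := rfl

theorem toField_br (X Y : Cplx (SField I U)) {x : M} (hx : x ∈ U) :
    toField (Cplx.bil (brOp I U) X Y) x = cbracket (toField X) (toField Y) x := by
  apply Cplx.ext <;> simp [cbracket, toField, brOp_apply _ _ hx]

theorem toField_cov {cov : CovariantDerivative I E (TangentSpace I : M → Type _)}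
    (hcov : IsSmoothConnection cov) (X Y : Cplx (SField I U)) {x : M} (hx : x ∈ U) :
    toField (Cplx.bil (covOp cov hcov U) X Y) x = ccov cov (toField X) (toField Y) x := by
  apply Cplx.ext
  · simp [ccov, toField, covOp_apply _ _ _ _ hx]
  · simp [ccov, toField, covOp_apply _ _ _ _ hx]

theorem toField_tor {cov : CovariantDerivative I E (TangentSpace I : M → Type _)}
    (hcov : IsSmoothConnection cov) (X Y : Cplx (SField I U)) {x : M} (hx : x ∈ U) :
    toField (Cplx.bil (covOp cov hcov U) X Y - Cplx.bil (covOp cov hcov U) Y X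
      - Cplx.bil (brOp I U) X Y) x = ctorsion cov x (toField X x) (toField Y x) := by
  apply Cplx.ext <;> simp only [ctorsion, toField, ← torsion_covOp hcov _ _ hx]
  · simp; abel
  · simp; abel

theorem toField_J (J : AlmostComplexStructure I M) (X : Cplx (SField I U)) (x : M) :
    toField (Cplx.lin (jOp J U) X) x
      = (toField X x).map (J x : TangentSpace I x →ₗ[ℝ] TangentSpace I x) := rfl

theorem isType10_toField {J : AlmostComplexStructure I M} {X : Cplx (SField I U)}
    (hX : Cplx.lin (jOp J U) X = Complex.I • X) (x : M) : IsType10 J (toField X x) := by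
  rw [IsType10, ← toField_J, hX]
  apply Cplx.ext <;> simp [toField]

theorem lin_conj (J : AlmostComplexStructure I M) {X : Cplx (SField I U)} :
    Cplx.lin (jOp J U) X.conj = -(Complex.I • X.conj) ↔
      Cplx.lin (jOp J U) X = Complex.I • X := by
  constructor <;> intro h <;> have h1 := congrArg Cplx.re h <;> have h2 := congrArg Cplx.im h <;>
    simp [Cplx.conj] at h1 h2 <;> apply Cplx.ext <;> simp [Cplx.conj, h1, h2]

theorem conj_conj {V : Type*} [AddCommGroup V] (v : Cplx V) : v.conj.conj = v := by
  apply Cplx.ext <;> simp [Cplx.conj]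

/-- The calculus of smooth complex fields on `U` defined by an almost Hermitian manifold, its
Levi-Civita connection and its canonical connection. -/
def fieldCalculus {g : ContMDiffRiemannianMetric I ∞ E (fun x : M => TangentSpace I x)}
    {J : AlmostComplexStructure I M} (hJ : IsAlmostHermitian g J)
    {D : CovariantDerivative I E (TangentSpace I : M → Type _)} (hD : IsLeviCivita g D)
    {nab : CovariantDerivative I E (TangentSpace I : M → Type _)} (hnab : IsCanonical g J nab)
    (U : Opens M) : HermitianCalculus (Cplx (SField I U)) (Cplx (SFun I U)) where
  ip := Cplx.bil (ipOp g U)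
  dv := Cplx.bil (dvOp I U)
  br := Cplx.bil (brOp I U)
  nab := Cplx.bil (covOp nab hnab.smooth U)
  lc := Cplx.bil (covOp D hD.smooth U)
  J := Cplx.lin (jOp J U)
  ip_symm X Y := by
    apply Cplx.ext <;> simp only [Cplx.bil_re, Cplx.bil_im]
    · rw [ipOp_symm g X.re, ipOp_symm g X.im]
    · rw [ipOp_symm g X.re, ipOp_symm g X.im, add_comm]
  br_skew X Y := by
    apply Cplx.ext <;> simp only [Cplx.bil_re, Cplx.bil_im, Cplx.neg_re, Cplx.neg_im]
    · rw [brOp_skew X.re, brOp_skew X.im]; abel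
    · rw [brOp_skew X.re, brOp_skew X.im]; abel
  jacobi X Y Z := by
    -- Complex trilinearity splits the identity into real ones: an even number of imaginary
    -- arguments contributes to the real part, an odd number to the imaginary part, with the sign of
    -- the power of √-1.
    have j := brOp_jacobi (I := I) (U := U)
    apply Cplx.ext <;> simp only [Cplx.bil_re, Cplx.bil_im, Cplx.add_re, Cplx.add_im, map_add,
      map_sub, LinearMap.add_apply, LinearMap.sub_apply]
    · linear_combination (norm := module) j X.re Y.re Z.re - j X.re Y.im Z.im
        - j X.im Y.re Z.im - j X.im Y.im Z.re
    · linear_combination (norm := module) j X.re Y.re Z.im + j X.re Y.im Z.re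
        + j X.im Y.re Z.re - j X.im Y.im Z.im
  dv_br X Y Z := by
    have j := dvOp_brOp (I := I) (U := U)
    apply Cplx.ext <;> simp only [Cplx.bil_re, Cplx.bil_im, Cplx.sub_re, Cplx.sub_im, map_add,
      map_sub, LinearMap.add_apply, LinearMap.sub_apply]
    · linear_combination (norm := module) j X.re Y.re Z.re - j X.re Y.im Z.im
        - j X.im Y.re Z.im - j X.im Y.im Z.re
    · linear_combination (norm := module) j X.re Y.re Z.im + j X.re Y.im Z.re
        + j X.im Y.re Z.re - j X.im Y.im Z.im
  nab_metric X Y Z := by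
    have j := dvOp_ipOp (U := U) hnab.smooth hnab.metric
    apply Cplx.ext <;> simp only [Cplx.bil_re, Cplx.bil_im, Cplx.add_re, Cplx.add_im, map_add,
      map_sub, LinearMap.add_apply, LinearMap.sub_apply]
    · linear_combination (norm := module) j X.re Y.re Z.re - j X.re Y.im Z.im
        - j X.im Y.re Z.im - j X.im Y.im Z.re
    · linear_combination (norm := module) j X.re Y.re Z.im + j X.re Y.im Z.re
        + j X.im Y.re Z.re - j X.im Y.im Z.im
  lc_metric X Y Z := by
    have j := dvOp_ipOp (U := U) hD.smooth hD.metric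
    apply Cplx.ext <;> simp only [Cplx.bil_re, Cplx.bil_im, Cplx.add_re, Cplx.add_im, map_add,
      map_sub, LinearMap.add_apply, LinearMap.sub_apply]
    · linear_combination (norm := module) j X.re Y.re Z.re - j X.re Y.im Z.im
        - j X.im Y.re Z.im - j X.im Y.im Z.re
    · linear_combination (norm := module) j X.re Y.re Z.im + j X.re Y.im Z.re
        + j X.im Y.re Z.re - j X.im Y.im Z.im
  lc_torsion X Y := by
    rw [← sub_eq_zero]
    refine eq_of_toField fun x hx => ?_
    rw [toField_tor hD.smooth X Y hx]
    apply Cplx.ext <;> simp [ctorsion, hD.torsion_eq_zero x, toField]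
  nab_J X Y := by
    apply Cplx.ext <;> simp [jOp_covOp hnab]
  J_sq X := by
    apply Cplx.ext <;> simp [jOp_sq]
  ip_J X Y := by
    apply Cplx.ext <;> simp [ipOp_jOp hJ]
  torsion11 X Y hX hY := by
    refine eq_of_toField fun x hx => ?_
    rw [toField_tor hnab.smooth X Y hx]
    rw [← conj_conj Y, lin_conj] at hY
    have h := hnab.torsion11 x _ _ (isType10_toField hX x) (isType10_toField hY x)
    rw [show (toField Y.conj x).conj = toField Y x by
      apply Cplx.ext <;> simp [toField, Cplx.conj]] at h
    rw [h]; rfl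

namespace HermitianCalculus

theorem ip_anti_anti {V F : Type*} [AddCommGroup V] [Module ℂ V] [AddCommGroup F] [Module ℂ F]
    {C : HermitianCalculus V F} {X Y : V} (hX : C.Anti X) (hY : C.Anti Y) : C.ip X Y = 0 := by
  have h := C.ip_J X Y
  rw [show C.J X = _ from hX, show C.J Y = _ from hY] at h
  simp only [map_smul, map_neg, LinearMap.smul_apply, LinearMap.neg_apply, smul_neg, neg_neg, smul_smul,
    Complex.I_mul_I] at h
  linear_combination (norm := module) (-(1 / 2) : ℂ) • h

end HermitianCalculus

/-! ### Expansion in a basis dual to itself under conjugation -/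

namespace Cplx

variable {V : Type*} [AddCommGroup V] [Module ℝ V]

/-- Complex coordinates on the complexification defined by a real basis. -/
def coordEquiv {ι : Type*} [Fintype ι] (b : Module.Basis ι ℝ V) : Cplx V ≃ₗ[ℂ] (ι → ℂ) where
  toFun v i := ⟨b.equivFun v.re i, b.equivFun v.im i⟩
  map_add' v w := by ext i; apply Complex.ext <;> simp
  map_smul' c v := by ext i; apply Complex.ext <;> simp
  invFun f := ⟨b.equivFun.symm fun i => (f i).re, b.equivFun.symm fun i => (f i).im⟩
  left_inv v := by
    apply Cplx.ext
    · exact b.equivFun.symm_apply_apply v.re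
    · exact b.equivFun.symm_apply_apply v.im
  right_inv f := by
    ext i
    apply Complex.ext
    · exact congrFun (b.equivFun.apply_symm_apply fun i => (f i).re) i
    · exact congrFun (b.equivFun.apply_symm_apply fun i => (f i).im) i

theorem finrank_eq [FiniteDimensional ℝ V] :
    Module.finrank ℂ (Cplx V) = Module.finrank ℝ V := by
  rw [(coordEquiv (Module.finBasis ℝ V)).finrank_eq]
  simp

/-- Expansion of a vector in a family that is dual to itself up to conjugation. -/
theorem eq_sum_of_dual {n : ℕ} [FiniteDimensional ℝ V] (hV : Module.finrank ℝ V = 2 * n)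
    (B : Cplx V →ₗ[ℂ] Cplx V →ₗ[ℂ] ℂ) (e f : Fin n → Cplx V)
    (hee : ∀ i j, B (e i) (e j) = 0) (hff : ∀ i j, B (f i) (f j) = 0)
    (hef : ∀ i j, B (e i) (f j) = if i = j then 1 else 0)
    (hfe : ∀ i j, B (f i) (e j) = if i = j then 1 else 0) (v : Cplx V) :
    v = ∑ a, (B v (f a) • e a + B v (e a) • f a) := by
  have pair_f : ∀ (c : Fin n ⊕ Fin n → ℂ) a,
      B (∑ s, c s • Sum.elim e f s) (f a) = c (.inl a) := by
    intro c a
    simp [Fintype.sum_sum_type, hef, hff, map_sum, LinearMap.sum_apply]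
  have pair_e : ∀ (c : Fin n ⊕ Fin n → ℂ) a,
      B (∑ s, c s • Sum.elim e f s) (e a) = c (.inr a) := by
    intro c a
    simp [Fintype.sum_sum_type, hee, hfe, map_sum, LinearMap.sum_apply]
  -- Pairing with the family reads off every coefficient, so its 2n vectors are independent; they
  -- span because the complexification has complex dimension 2n.
  have hli : LinearIndependent ℂ (Sum.elim e f) := by
    rw [Fintype.linearIndependent_iff]
    rintro c hc (a | a)
    · rw [← pair_f c a, hc]; simp
    · rw [← pair_e c a, hc]; simp
  have hspan : v ∈ Submodule.span ℂ (Set.range (Sum.elim e f)) := by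
    have : FiniteDimensional ℂ (Cplx V) := (coordEquiv (Module.finBasis ℝ V)).symm.finiteDimensional
    rw [hli.span_eq_top_of_card_eq_finrank' (by rw [finrank_eq, hV]; simp; ring)]
    trivial
  obtain ⟨c, rfl⟩ := (Submodule.mem_span_range_iff_exists_fun ℂ).1 hspan
  simp only [pair_f, pair_e]
  simp [Fintype.sum_sum_type, Finset.sum_add_distrib]

end Cplx

/-- `cinner` as a complex bilinear form. -/
def cinnerForm (g : ContMDiffRiemannianMetric I ∞ E (fun x : M => TangentSpace I x)) (x : M) :
    Cplx (TangentSpace I x) →ₗ[ℂ] Cplx (TangentSpace I x) →ₗ[ℂ] ℂ :=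
  LinearMap.mk₂ ℂ (fun v w => cinner g v w)
    (fun v v' w => by apply Complex.ext <;> simp [cinner] <;> ring)
    (fun c v w => by apply Complex.ext <;> simp [cinner] <;> ring)
    (fun v w w' => by apply Complex.ext <;> simp [cinner] <;> ring)
    (fun c v w => by apply Complex.ext <;> simp [cinner] <;> ring)

/-- `ctorsion` as a complex bilinear map. -/
def ctorsionMap (cov : CovariantDerivative I E (TangentSpace I : M → Type _)) (x : M) :
    Cplx (TangentSpace I x) →ₗ[ℂ] Cplx (TangentSpace I x) →ₗ[ℂ] Cplx (TangentSpace I x) :=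
  LinearMap.mk₂ ℂ (fun v w => ctorsion cov x v w)
    (fun v v' w => by apply Cplx.ext <;> simp [ctorsion] <;> abel)
    (fun c v w => by apply Cplx.ext <;> simp [ctorsion] <;> module)
    (fun v w w' => by apply Cplx.ext <;> simp [ctorsion] <;> abel)
    (fun c v w => by apply Cplx.ext <;> simp [ctorsion] <;> module)

/-! ### Translating complex fields and frame components into the calculus -/

/-- The complex field `X` agrees on `U` with a smooth field. -/
def Represents (X : CField I M) (X' : Cplx (SField I U)) : Prop := ∀ x ∈ U, X x = toField X' x

/-- Connections are local, so cutting a field off outside U changes nothing on U. -/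
theorem cov_congr_on (cov : CovariantDerivative I E (TangentSpace I : M → Type _))
    {Y : ∀ x : M, TangentSpace I x} {Y' : SField I U} (h : ∀ x ∈ U, Y x = Y'.1 x) {x : M}
    (hx : x ∈ U) : cov Y x = cov Y'.1 x := by
  have hY := SField.mdifferentiableAt Y' hx
  refine cov.isCovariantDerivativeOn.congr_of_eqOn (s := U) (hY.congr_of_eventuallyEq ?_) hY
    (U.isOpen.mem_nhds hx) h
  filter_upwards [U.isOpen.mem_nhds hx] with y hy
  rw [h y hy]

namespace Represents

variable {X Y : CField I M} {X' Y' : Cplx (SField I U)}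

theorem sub (hX : Represents X X') (hY : Represents Y Y') : Represents (X - Y) (X' - Y') :=
  fun x hx => by rw [Pi.sub_apply, hX x hx, hY x hx, toField_sub]

theorem br (hX : Represents X X') (hY : Represents Y Y') :
    Represents (cbracket X Y) (Cplx.bil (brOp I U) X' Y') := fun x hx => by
  rw [toField_br _ _ hx]
  have hXr : ∀ y ∈ U, (X y).re = (toField X' y).re := fun y hy => by rw [hX y hy]
  have hXi : ∀ y ∈ U, (X y).im = (toField X' y).im := fun y hy => by rw [hX y hy]
  have hYr : ∀ y ∈ U, (Y y).re = (toField Y' y).re := fun y hy => by rw [hY y hy]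
  have hYi : ∀ y ∈ U, (Y y).im = (toField Y' y).im := fun y hy => by rw [hY y hy]
  simp only [cbracket]
  rw [mlieBracket_congr_on hXr hYr hx, mlieBracket_congr_on hXi hYi hx,
    mlieBracket_congr_on hXr hYi hx, mlieBracket_congr_on hXi hYr hx]

theorem cov {cov : CovariantDerivative I E (TangentSpace I : M → Type _)}
    (hcov : IsSmoothConnection cov) (hX : Represents X X') (hY : Represents Y Y') :
    Represents (ccov cov X Y) (Cplx.bil (covOp cov hcov U) X' Y') := fun x hx => by
  rw [toField_cov _ _ _ hx]
  have hYr : ∀ y ∈ U, (Y y).re = Y'.re.1 y := fun y hy => by rw [hY y hy]; rfl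
  have hYi : ∀ y ∈ U, (Y y).im = Y'.im.1 y := fun y hy => by rw [hY y hy]; rfl
  simp only [ccov]
  rw [cov_congr_on cov hYr hx, cov_congr_on cov hYi hx, hX x hx]
  rfl

end Represents

/-- The members of a smooth frame, cut off outside `U`. -/
def smoothFrame {n : ℕ} {e : Fin n → CField I M} (he : ∀ i, (e i).SmoothOn U) :
    Idx n → Cplx (SField I U)
  | .hol i => ⟨SField.cut _ (he i).1, SField.cut _ (he i).2⟩
  | .bar i => Cplx.conj ⟨SField.cut _ (he i).1, SField.cut _ (he i).2⟩

theorem represents_smoothFrame {n : ℕ} {e : Fin n → CField I M} (he : ∀ i, (e i).SmoothOn U)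
    (A : Idx n) : Represents (fr e A) (smoothFrame he A) := fun x hx => by
  cases A with
  | hol i =>
    apply Cplx.ext
    · exact (SField.cut_apply (he i).1 hx).symm
    · exact (SField.cut_apply (he i).2 hx).symm
  | bar i =>
    apply Cplx.ext
    · exact (SField.cut_apply (he i).1 hx).symm
    · exact congrArg Neg.neg (SField.cut_apply (he i).2 hx).symm

section Components

variable {g : ContMDiffRiemannianMetric I ∞ E (fun x : M => TangentSpace I x)}
  {J : AlmostComplexStructure I M} (hJ : IsAlmostHermitian g J)
  {D : CovariantDerivative I E (TangentSpace I : M → Type _)} (hD : IsLeviCivita g D)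
  {nab : CovariantDerivative I E (TangentSpace I : M → Type _)} (hnab : IsCanonical g J nab)

theorem Represents.tor {X Y : CField I M} {X' Y' : Cplx (SField I U)} (hX : Represents X X')
    (hY : Represents Y Y') : Represents (fun y => ctorsion nab y (X y) (Y y))
      ((fieldCalculus hJ hD hnab U).tor X' Y') := fun x hx => by
  simp only [hX x hx, hY x hx]
  exact (toField_tor hnab.smooth X' Y' hx).symm

theorem Represents.dtor {Z X Y : CField I M} {Z' X' Y' : Cplx (SField I U)}
    (hZ : Represents Z Z') (hX : Represents X X')
    (hY : Represents Y Y') : Represents (ccovTorsion nab Z X Y)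
      ((fieldCalculus hJ hD hnab U).dtor Z' X' Y') :=
  ((hZ.cov hnab.smooth (hX.tor hJ hD hnab hY)).sub
    ((hZ.cov hnab.smooth hX).tor hJ hD hnab hY)).sub (hX.tor hJ hD hnab (hZ.cov hnab.smooth hY))

theorem Represents.curvNab {Z X Y : CField I M} {Z' X' Y' : Cplx (SField I U)}
    (hX : Represents X X') (hY : Represents Y Y') (hZ : Represents Z Z') :
    Represents (ccurv nab X Y Z) ((fieldCalculus hJ hD hnab U).curvNab X' Y' Z') :=
  ((hX.cov hnab.smooth (hY.cov hnab.smooth hZ)).sub (hY.cov hnab.smooth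
    (hX.cov hnab.smooth hZ))).sub ((hX.br hY).cov hnab.smooth hZ)

theorem Represents.curvLC {Z X Y : CField I M} {Z' X' Y' : Cplx (SField I U)}
    (hX : Represents X X') (hY : Represents Y Y') (hZ : Represents Z Z') :
    Represents (ccurv D X Y Z) ((fieldCalculus hJ hD hnab U).curvLC X' Y' Z') :=
  ((hX.cov hD.smooth (hY.cov hD.smooth hZ)).sub (hY.cov hD.smooth
    (hX.cov hD.smooth hZ))).sub ((hX.br hY).cov hD.smooth hZ)

theorem Represents.inner {X Y : CField I M} {X' Y' : Cplx (SField I U)}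
    (hX : Represents X X') (hY : Represents Y Y') {x : M} (hx : x ∈ U) :
    cinner g (X x) (Y x) = evalAt x ((fieldCalculus hJ hD hnab U).ip X' Y') := by
  rw [hX x hx, hY x hx]
  exact (evalAt_ip g X' Y' hx).symm

variable {n : ℕ} {e : Fin n → CField I M} (he : IsUnitaryFrameOn g J e U)

local notation "𝒞" => fieldCalculus hJ hD hnab U
local notation "ε" => smoothFrame (IsUnitaryFrameOn.smooth he)

theorem curv_lc_eq {p : M} (hp : p ∈ U) (A B C F : Idx n) :
    curv g D e p A B C F = evalAt p ((𝒞).ip ((𝒞).curvLC (ε C) (ε F) (ε A)) (ε B)) :=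
  ((represents_smoothFrame he.smooth C).curvLC hJ hD hnab (represents_smoothFrame he.smooth F)
    (represents_smoothFrame he.smooth A)).inner hJ hD hnab (represents_smoothFrame he.smooth B) hp

theorem curv_nab_eq {p : M} (hp : p ∈ U) (A B C F : Idx n) :
    curv g nab e p A B C F = evalAt p ((𝒞).ip ((𝒞).curvNab (ε C) (ε F) (ε A)) (ε B)) :=
  ((represents_smoothFrame he.smooth C).curvNab hJ hD hnab (represents_smoothFrame he.smooth F)
    (represents_smoothFrame he.smooth A)).inner hJ hD hnab (represents_smoothFrame he.smooth B) hp

theorem tor_eq {p : M} (hp : p ∈ U) (A B C : Idx n) :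
    tor g nab e p A B C = evalAt p ((𝒞).ip ((𝒞).tor (ε A) (ε B)) (ε C.conj)) :=
  ((represents_smoothFrame he.smooth A).tor hJ hD hnab
    (represents_smoothFrame he.smooth B)).inner hJ hD hnab
      (represents_smoothFrame he.smooth C.conj) hp

theorem dtor_eq {p : M} (hp : p ∈ U) (A B C F : Idx n) :
    dtor g nab e p A B C F = evalAt p ((𝒞).ip ((𝒞).dtor (ε C) (ε A) (ε B)) (ε F.conj)) :=
  ((represents_smoothFrame he.smooth C).dtor hJ hD hnab (represents_smoothFrame he.smooth A)
    (represents_smoothFrame he.smooth B)).inner hJ hD hnab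
      (represents_smoothFrame he.smooth F.conj) hp

theorem hol_smoothFrame (i : Fin n) : (𝒞).Hol (ε (hol i)) := by
  refine eq_of_toField fun x hx => ?_
  have h := he.type10 i x hx
  rw [show e i x = toField (ε (hol i)) x from represents_smoothFrame he.smooth (hol i) x hx] at h
  refine Eq.trans h ?_
  apply Cplx.ext <;> simp [toField]

theorem anti_smoothFrame (i : Fin n) : (𝒞).Anti (ε (bar i)) :=
  (lin_conj J).2 (hol_smoothFrame hJ hD hnab he i)

theorem toField_expand
    {g : ContMDiffRiemannianMetric I ∞ E (fun x : M => TangentSpace I x)}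
    {J : AlmostComplexStructure I M} (hJ : IsAlmostHermitian g J)
    {D : CovariantDerivative I E (TangentSpace I : M → Type _)} (hD : IsLeviCivita g D)
    {nab : CovariantDerivative I E (TangentSpace I : M → Type _)} (hnab : IsCanonical g J nab)
    {n : ℕ} {e : Fin n → CField I M} (he : IsUnitaryFrameOn g J e U) {p : M} (hp : p ∈ U)
    (hE : Module.finrank ℝ E = 2 * n) (v : Cplx (TangentSpace I p)) :
    v = ∑ a, (cinner g v (toField (smoothFrame he.smooth (bar a)) p) • toField (smoothFrame he.smooth (hol a)) p
      + cinner g v (toField (smoothFrame he.smooth (hol a)) p) • toField (smoothFrame he.smooth (bar a)) p) := by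
  have hi : ∀ X Y : Cplx (SField I U), cinnerForm g p (toField X p) (toField Y p)
      = evalAt p ((fieldCalculus hJ hD hnab U).ip X Y) := fun X Y => (evalAt_ip g X Y hp).symm
  have hu : ∀ i j, cinnerForm g p (toField (smoothFrame he.smooth (hol i)) p) (toField (smoothFrame he.smooth (bar j)) p)
      = if i = j then 1 else 0 := by
    intro i j
    rw [← he.unitary i j p hp]
    exact (congrArg₂ (cinner g) (represents_smoothFrame he.smooth (hol i) p hp)
      (represents_smoothFrame he.smooth (bar j) p hp)).symm
  have : FiniteDimensional ℝ (TangentSpace I p) := inferInstanceAs (FiniteDimensional ℝ E)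
  have hT : Module.finrank ℝ (TangentSpace I p) = 2 * n := hE
  refine Cplx.eq_sum_of_dual (V := TangentSpace I p) (n := n) hT (cinnerForm g p) (fun a => toField (smoothFrame he.smooth (hol a)) p)
    (fun a => toField (smoothFrame he.smooth (bar a)) p) ?_ ?_ hu ?_ v
  · intro i j
    rw [hi, HermitianCalculus.ip_hol_hol (hol_smoothFrame hJ hD hnab he i)
      (hol_smoothFrame hJ hD hnab he j), map_zero]
  · intro i j
    rw [hi, HermitianCalculus.ip_anti_anti (anti_smoothFrame hJ hD hnab he i)
      (anti_smoothFrame hJ hD hnab he j), map_zero]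
  · intro i j
    rw [hi, (fieldCalculus hJ hD hnab U).ip_symm, ← hi, hu]
    simp [eq_comm]

theorem evalAt_ip_expand {p : M} (hp : p ∈ U) (hE : Module.finrank ℝ E = 2 * n) (X Y : Cplx (SField I U)) :
    evalAt p ((𝒞).ip X Y) = ∑ a,
      (evalAt p ((𝒞).ip X (ε (hol a))) * evalAt p ((𝒞).ip Y (ε (bar a)))
        + evalAt p ((𝒞).ip X (ε (bar a))) * evalAt p ((𝒞).ip Y (ε (hol a)))) := by
  have hi : ∀ X Y : Cplx (SField I U), evalAt p ((𝒞).ip X Y)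
      = cinnerForm g p (toField X p) (toField Y p) := fun X Y => evalAt_ip g X Y hp
  rw [hi]
  conv_lhs => rw [toField_expand hJ hD hnab he hp hE (toField Y p)]
  rw [map_sum]
  refine Finset.sum_congr rfl fun a _ => ?_
  rw [map_add, map_smul, map_smul, hi, hi, hi, hi]
  simp only [smul_eq_mul]
  rw [mul_comm, mul_comm (cinner _ _ _)]
  exact congrArg₂ _ rfl rfl

/-- The torsion is tensorial, so its first argument may be expanded in the frame at the single point
p. -/
theorem evalAt_ip_tor_expand {p : M} (hp : p ∈ U) (hE : Module.finrank ℝ E = 2 * n) (X Y Z : Cplx (SField I U)) :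
    evalAt p ((𝒞).ip ((𝒞).tor X Y) Z) = ∑ a,
      (evalAt p ((𝒞).ip X (ε (bar a))) * evalAt p ((𝒞).ip ((𝒞).tor (ε (hol a)) Y) Z)
        + evalAt p ((𝒞).ip X (ε (hol a))) * evalAt p ((𝒞).ip ((𝒞).tor (ε (bar a)) Y) Z)) := by
  have hi : ∀ X Y : Cplx (SField I U), evalAt p ((𝒞).ip X Y)
      = cinnerForm g p (toField X p) (toField Y p) := fun X Y => evalAt_ip g X Y hp
  have ht : ∀ X Y : Cplx (SField I U), toField ((𝒞).tor X Y) p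
      = ctorsionMap nab p (toField X p) (toField Y p) := fun X Y => toField_tor hnab.smooth X Y hp
  rw [hi, ht]
  conv_lhs => rw [toField_expand hJ hD hnab he hp hE (toField X p)]
  rw [map_sum, LinearMap.sum_apply, map_sum, LinearMap.sum_apply]
  refine Finset.sum_congr rfl fun a _ => ?_
  rw [hi, hi, hi, hi, ht, ht]
  simp only [map_add, map_smul, LinearMap.add_apply, LinearMap.smul_apply, smul_eq_mul]
  rfl

end Components

/-! ### Quasi Kähler and nearly Kähler manifolds in the calculus -/

theorem mvfderiv_complex {f : M → ℂ} {a b : M → ℝ} {x : M}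
    (ha : MDifferentiableAt I 𝓘(ℝ, ℝ) a x) (hb : MDifferentiableAt I 𝓘(ℝ, ℝ) b x)
    (hf : ∀ᶠ y in nhds x, f y = ⟨a y, b y⟩) (v : TangentSpace I x) :
    mvfderiv I f x v = ⟨mvfderiv I a x v, mvfderiv I b x v⟩ := by
  have h0 : f =ᶠ[nhds x] a • (fun _ => (1 : ℂ)) + b • (fun _ => Complex.I) := by
    filter_upwards [hf] with y hy
    rw [hy]
    apply Complex.ext <;> simp
  have h1 : mvfderiv I f x = mvfderiv I (a • (fun _ => (1 : ℂ)) + b • (fun _ => Complex.I)) x := by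
    ext v
    simp only [mvfderiv, h0.mfderiv_eq]
    rfl
  have c : ∀ z : ℂ, MDifferentiableAt I 𝓘(ℝ, ℂ) (fun _ : M => z) x :=
    fun _ => mdifferentiableAt_const
  rw [h1, mvfderiv_add (ha.smul (c 1)) (hb.smul (c Complex.I)), mvfderiv_smul ha (c 1),
    mvfderiv_smul hb (c Complex.I), mvfderiv_const, mvfderiv_const]
  apply Complex.ext <;> simp

theorem cderiv_eq_evalAt {f : M → ℂ} {f' : Cplx (SFun I U)} (hf : ∀ y ∈ U, f y = evalAt y f')
    (X : Cplx (SField I U)) {x : M} (hx : x ∈ U) :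
    cderiv f x (toField X x) = evalAt x (Cplx.bil (dvOp I U) X f') := by
  have h := fun v => mvfderiv_complex (I := I) (SFun.mdifferentiableAt f'.re hx)
    (SFun.mdifferentiableAt f'.im hx)
    (Filter.mem_of_superset (U.isOpen.mem_nhds hx) fun y hy => hf y hy) v
  rw [cderiv, h, h]
  apply Complex.ext <;> simp [toField, dvOp_apply _ _ hx, sub_eq_add_neg]

section Special

variable {g : ContMDiffRiemannianMetric I ∞ E (fun x : M => TangentSpace I x)}
  {J : AlmostComplexStructure I M} (hJ : IsAlmostHermitian g J)
  {D : CovariantDerivative I E (TangentSpace I : M → Type _)} (hD : IsLeviCivita g D)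
  {nab : CovariantDerivative I E (TangentSpace I : M → Type _)} (hnab : IsCanonical g J nab)

theorem dFundForm_eq_evalAt (X Y Z : Cplx (SField I U)) {x : M} (hx : x ∈ U) :
    dFundForm g J (toField X) (toField Y) (toField Z) x
      = evalAt x ((fieldCalculus hJ hD hnab U).dOmega X Y Z) := by
  have hF : ∀ A B : Cplx (SField I U), ∀ y ∈ U, fundForm g J (toField A y) (toField B y)
      = evalAt y ((fieldCalculus hJ hD hnab U).ip ((fieldCalculus hJ hD hnab U).J A) B) :=
    fun A B y hy => (evalAt_ip g (Cplx.lin (jOp J U) A) B hy).symm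
  have hd : ∀ A B C : Cplx (SField I U),
      cderiv (fun y => fundForm g J (toField A y) (toField B y)) x (toField C x)
      = evalAt x ((fieldCalculus hJ hD hnab U).dv C
        ((fieldCalculus hJ hD hnab U).ip ((fieldCalculus hJ hD hnab U).J A) B)) :=
    fun A B C => cderiv_eq_evalAt (hF A B) C hx
  simp only [dFundForm, HermitianCalculus.dOmega, map_add, map_sub, ← toField_br _ _ hx, hd,
    hF _ _ x hx]
  rfl

theorem tor_anti_of_quasiKahler (h : IsQuasiKahler g J) {X Y Z : Cplx (SField I U)}
    (hX : (fieldCalculus hJ hD hnab U).Hol X) (hY : (fieldCalculus hJ hD hnab U).Anti Y)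
    (hZ : (fieldCalculus hJ hD hnab U).Anti Z) :
    (fieldCalculus hJ hD hnab U).ip ((fieldCalculus hJ hD hnab U).tor Y Z) X = 0 := by
  have md : ∀ A : Cplx (SField I U), ∀ x ∈ U, (toField A).MDiffAt x := fun A x hx =>
    ⟨SField.mdifferentiableAt A.re hx, SField.mdifferentiableAt A.im hx⟩
  have hY' : Cplx.lin (jOp J U) Y.conj = Complex.I • Y.conj := by
    rw [← lin_conj, conj_conj]; exact hY
  have hZ' : Cplx.lin (jOp J U) Z.conj = Complex.I • Z.conj := by
    rw [← lin_conj, conj_conj]; exact hZ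
  have h0 : (fieldCalculus hJ hD hnab U).dOmega X Y Z = 0 := by
    refine eq_of_evalAt fun x hx => ?_
    have hq := h x (toField X) (toField Y.conj) (toField Z.conj) (md _ x hx) (md _ x hx)
      (md _ x hx) (isType10_toField hX x) (isType10_toField hY' x) (isType10_toField hZ' x)
    have hc : ∀ A : Cplx (SField I U), CField.conj (toField A.conj) = toField A := fun A => by
      funext y; apply Cplx.ext <;> simp [CField.conj, toField, Cplx.conj]
    rw [hc, hc, dFundForm_eq_evalAt hJ hD hnab X Y Z hx] at hq
    rw [hq, map_zero]
  rw [HermitianCalculus.dOmega_hol_anti_anti hX hY hZ] at h0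
  simpa using h0

/-- The torsion is a real tensor, so this is the complex conjugate of the hypothesis. -/
theorem tor_hol_of_tor_anti (h : ∀ X Y Z : Cplx (SField I U),
      (fieldCalculus hJ hD hnab U).Hol X → (fieldCalculus hJ hD hnab U).Anti Y →
      (fieldCalculus hJ hD hnab U).Anti Z →
      (fieldCalculus hJ hD hnab U).ip ((fieldCalculus hJ hD hnab U).tor Y Z) X = 0)
    (X Y Z : Cplx (SField I U)) (hX : (fieldCalculus hJ hD hnab U).Hol X)
    (hY : (fieldCalculus hJ hD hnab U).Hol Y) (hZ : (fieldCalculus hJ hD hnab U).Anti Z) :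
    (fieldCalculus hJ hD hnab U).ip ((fieldCalculus hJ hD hnab U).tor X Y) Z = 0 := by
  have hZ' : (fieldCalculus hJ hD hnab U).Hol Z.conj := by
    refine (lin_conj J).1 ?_; rw [conj_conj]; exact hZ
  have h0 := h Z.conj X.conj Y.conj hZ' ((lin_conj J).2 hX) ((lin_conj J).2 hY)
  have ht : (fieldCalculus hJ hD hnab U).tor X.conj Y.conj
      = ((fieldCalculus hJ hD hnab U).tor X Y).conj := by
    simp only [HermitianCalculus.tor, fieldCalculus, Cplx.bil_conj]
    apply Cplx.ext <;> simp [Cplx.conj]; abel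
  rw [ht] at h0
  have h1 := congrArg Cplx.conj (((Cplx.bil_conj (ipOp g U) _ _).symm).trans h0)
  rw [conj_conj] at h1
  refine h1.trans ?_
  apply Cplx.ext <;> simp [Cplx.conj]

theorem nearlyKahler_fieldCalculus (h : IsNearlyKahler J D) :
    (fieldCalculus hJ hD hnab U).NearlyKahler := fun X Y => by
  have j := nearlyKahler_covOp (U := U) hD.smooth h
  simp only [fieldCalculus]
  apply Cplx.ext <;> simp only [Cplx.bil_re, Cplx.bil_im, Cplx.lin_re, Cplx.lin_im, Cplx.add_re,
    Cplx.add_im, Cplx.sub_re, Cplx.sub_im, map_add, map_sub, Cplx.zero_re, Cplx.zero_im]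
  · linear_combination (norm := module) j X.re Y.re - j X.im Y.im
  · linear_combination (norm := module) j X.re Y.im + j X.im Y.re

end Special

/-! ### The curvature formula and its two special cases -/

theorem curv_lc_formula
    {g : ContMDiffRiemannianMetric I ∞ E (fun x : M => TangentSpace I x)}
    {J : AlmostComplexStructure I M} (hJ : IsAlmostHermitian g J)
    {D : CovariantDerivative I E (TangentSpace I : M → Type _)} (hD : IsLeviCivita g D)
    {nab : CovariantDerivative I E (TangentSpace I : M → Type _)} (hnab : IsCanonical g J nab)
    {n : ℕ} {e : Fin n → CField I M} (he : IsUnitaryFrameOn g J e U)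
    (hE : Module.finrank ℝ E = 2 * n) {p : M} (hp : p ∈ U)
    (i j k l : Fin n) :
    curv g D e p (hol i) (hol j) (hol k) (bar l) =
        1 / 2 * (curv g nab e p (hol k) (bar l) (hol i) (hol j)
            - curv g nab e p (hol i) (bar l) (hol j) (hol k)
            - curv g nab e p (hol j) (bar l) (hol k) (hol i))
        + 1 / 2 * (dtor g nab e p (hol i) (hol j) (hol k) (hol l)
            - ∑ a, tor g nab e p (hol i) (hol j) (bar a) * tor g nab e p (bar l) (bar a) (bar k))
        + 1 / 4 * ∑ a, (tor g nab e p (hol j) (hol a) (hol l)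
              * tor g nab e p (hol i) (hol k) (hol a)
            - tor g nab e p (hol i) (hol a) (hol l) * tor g nab e p (hol j) (hol k) (hol a))
        + 1 / 4 * ∑ a, tor g nab e p (bar l) (bar a) (bar i) *
            (tor g nab e p (hol j) (hol k) (bar a) - tor g nab e p (hol k) (hol a) (bar j)
              + tor g nab e p (hol a) (hol j) (bar k))
        - 1 / 4 * ∑ a, tor g nab e p (bar l) (bar a) (bar j) *
            (tor g nab e p (hol i) (hol k) (bar a) - tor g nab e p (hol k) (hol a) (bar i)
              + tor g nab e p (hol a) (hol i) (bar k)) := by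
  simp only [curv_lc_eq hJ hD hnab he hp, curv_nab_eq hJ hD hnab he hp, tor_eq hJ hD hnab he hp,
    dtor_eq hJ hD hnab he hp, Idx.conj]
  have hH := hol_smoothFrame hJ hD hnab he
  have hA := anti_smoothFrame hJ hD hnab he
  have ex := evalAt_ip_expand hJ hD hnab he hp hE
  have et := evalAt_ip_tor_expand hJ hD hnab he hp hE
  generalize fieldCalculus hJ hD hnab U = C at hH hA ex et ⊢
  generalize smoothFrame he.smooth = f at hH hA ex et ⊢
  -- All indices of t are lowered by the metric, so t A B F stands for τ_{AB}^{F̄}.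
  obtain ⟨t, ht⟩ : ∃ t : Idx n → Idx n → Idx n → ℂ,
      ∀ A B F, evalAt p (C.ip (C.tor (f A) (f B)) (f F)) = t A B F := ⟨_, fun _ _ _ => rfl⟩
  have sk : ∀ A B F, t A B F = -t B A F := fun A B F => by
    rw [← ht, ← ht, HermitianCalculus.tor_skew]; simp
  have hb : ∀ a b F, t (hol a) (bar b) F = 0 := fun a b F => by
    rw [← ht, HermitianCalculus.tor_hol_anti (hH a) (hA b)]; simp
  have bh : ∀ a b F, t (bar a) (hol b) F = 0 := fun a b F => by rw [sk, hb, neg_zero]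
  have hu : ∀ A B F, evalAt p (C.ip (C.diff (f A) (f B)) (f F))
      = 1 / 2 * (-t A B F + t B F A - t F A B) := fun A B F => by
    have h := congrArg (evalAt p) (HermitianCalculus.two_ip_diff (C := C) (f A) (f B) (f F))
    simp only [map_smul, map_add, map_sub, map_neg, ht, smul_eq_mul] at h
    linear_combination 1 / 2 * h
  -- The vanishing (1,1)-part leaves one torsion in each component of S(e_l̄, e_i), and in S(e_k,
  -- e_j) one paired with ē_a and three paired with e_a.
  have hdd : ∀ i j, evalAt p (C.ip (C.diff (f (bar l)) (f (hol i))) (C.diff (f (hol k)) (f (hol j))))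
      = ∑ a, 1 / 4 * (-(t (hol i) (hol a) (bar l) * t (hol k) (hol j) (bar a))
        + t (bar l) (bar a) (hol i) * (-t (hol k) (hol j) (hol a) + t (hol j) (hol a) (hol k)
          - t (hol a) (hol k) (hol j))) := fun i j => by
    rw [ex]
    refine Finset.sum_congr rfl fun a _ => ?_
    simp only [hu, hb, bh]
    rw [sk (bar a) (bar l)]
    ring
  have htt : ∀ i j k, evalAt p (C.ip (C.tor (C.tor (f (hol i)) (f (hol j))) (f (bar l))) (f (hol k)))
      = ∑ a, t (hol i) (hol j) (hol a) * -t (bar l) (bar a) (hol k) := fun i j k => by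
    rw [et]
    refine Finset.sum_congr rfl fun a _ => ?_
    simp only [ht, hb]
    rw [sk (bar a) (bar l)]
    ring
  have main := congrArg (evalAt p)
    (HermitianCalculus.two_ip_curvLC_hol (hH k) (hA l) (hH i) (hH j))
  rw [HermitianCalculus.ip_dtor_anti (hH k) (hA l) (hH i) (hH j),
    HermitianCalculus.ip_dtor_anti (hH i) (hA l) (hH j) (hH k),
    HermitianCalculus.ip_dtor_anti (hH j) (hA l) (hH k) (hH i),
    C.ip_symm (C.diff (f (hol k)) (f (hol i)))] at main
  simp only [map_smul, map_add, map_sub, map_neg, smul_eq_mul, hdd, htt] at main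
  simp only [ht]
  -- The torsion products from Bianchi and from S combine summand by summand, using only skewness in
  -- the lower indices.
  have hs : -(∑ a, t (hol k) (hol i) (hol a) * -t (bar l) (bar a) (hol j))
      + (∑ a, t (hol i) (hol j) (hol a) * -t (bar l) (bar a) (hol k))
      - (∑ a, t (hol j) (hol k) (hol a) * -t (bar l) (bar a) (hol i))
      - 2 * (∑ a, 1 / 4 * (-(t (hol i) (hol a) (bar l) * t (hol k) (hol j) (bar a))
        + t (bar l) (bar a) (hol i) * (-t (hol k) (hol j) (hol a) + t (hol j) (hol a) (hol k)
          - t (hol a) (hol k) (hol j))))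
      + 2 * (∑ a, 1 / 4 * (-(t (hol j) (hol a) (bar l) * t (hol k) (hol i) (bar a))
        + t (bar l) (bar a) (hol j) * (-t (hol k) (hol i) (hol a) + t (hol i) (hol a) (hol k)
          - t (hol a) (hol k) (hol i))))
      = -(∑ a, t (hol i) (hol j) (hol a) * t (bar l) (bar a) (hol k))
        + 1 / 2 * (∑ a, (t (hol j) (hol a) (bar l) * t (hol i) (hol k) (bar a)
            - t (hol i) (hol a) (bar l) * t (hol j) (hol k) (bar a)))
        + 1 / 2 * (∑ a, t (bar l) (bar a) (hol i) *
            (t (hol j) (hol k) (hol a) - t (hol k) (hol a) (hol j) + t (hol a) (hol j) (hol k)))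
        - 1 / 2 * (∑ a, t (bar l) (bar a) (hol j) *
            (t (hol i) (hol k) (hol a) - t (hol k) (hol a) (hol i)
              + t (hol a) (hol i) (hol k))) := by
    simp only [Finset.mul_sum, ← Finset.sum_neg_distrib, ← Finset.sum_add_distrib,
      ← Finset.sum_sub_distrib]
    refine Finset.sum_congr rfl fun a _ => ?_
    rw [sk (hol k) (hol i) (hol a), sk (hol k) (hol j) (hol a), sk (hol k) (hol j) (bar a),
      sk (hol k) (hol i) (bar a), sk (hol a) (hol k) (hol j), sk (hol a) (hol k) (hol i),
      sk (hol a) (hol j) (hol k), sk (hol a) (hol i) (hol k)]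
    ring
  linear_combination 1 / 2 * main + 1 / 2 * hs

/-- Under the quasi Kähler condition on the torsion, the curvature of the canonical connection
satisfies the usual first Bianchi identity on `(1,0)`-vectors. -/
theorem curv_nab_cyclic
    {g : ContMDiffRiemannianMetric I ∞ E (fun x : M => TangentSpace I x)}
    {J : AlmostComplexStructure I M} (hJ : IsAlmostHermitian g J)
    {D : CovariantDerivative I E (TangentSpace I : M → Type _)} (hD : IsLeviCivita g D)
    {nab : CovariantDerivative I E (TangentSpace I : M → Type _)} (hnab : IsCanonical g J nab)
    {n : ℕ} {e : Fin n → CField I M} (he : IsUnitaryFrameOn g J e U)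
    (hE : Module.finrank ℝ E = 2 * n)
    (h : ∀ X Y Z : Cplx (SField I U),
      (fieldCalculus hJ hD hnab U).Hol X → (fieldCalculus hJ hD hnab U).Hol Y →
      (fieldCalculus hJ hD hnab U).Anti Z →
      (fieldCalculus hJ hD hnab U).ip ((fieldCalculus hJ hD hnab U).tor X Y) Z = 0)
    {p : M} (hp : p ∈ U) (i j k l : Fin n) :
    curv g nab e p (hol k) (bar l) (hol i) (hol j) + curv g nab e p (hol i) (bar l) (hol j) (hol k)
      + curv g nab e p (hol j) (bar l) (hol k) (hol i) = 0 := by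
  simp only [curv_nab_eq hJ hD hnab he hp]
  have hH := hol_smoothFrame hJ hD hnab he
  have hA := anti_smoothFrame hJ hD hnab he
  have et := evalAt_ip_tor_expand hJ hD hnab he hp hE
  generalize fieldCalculus hJ hD hnab U = C at h hH hA et ⊢
  generalize smoothFrame he.smooth = f at hH hA et ⊢
  have htt : ∀ i j k, evalAt p (C.ip (C.tor (C.tor (f (hol i)) (f (hol j))) (f (hol k)))
      (f (bar l))) = 0 := fun i j k => by
    rw [et]
    refine Finset.sum_eq_zero fun a _ => ?_
    -- Here τ(e_a, e_k) has no (1,0)-part by hypothesis, and τ(ē_a, e_k) = 0.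
    rw [h _ _ _ (hH a) (hH k) (hA l), HermitianCalculus.tor_anti_hol (hA a) (hH k)]
    simp
  have b := congrArg (fun X => evalAt p (C.ip X (f (bar l))))
    (HermitianCalculus.bianchi (C := C) (f (hol i)) (f (hol j)) (f (hol k)))
  simp only [map_add, LinearMap.add_apply, htt,
    HermitianCalculus.ip_dtor_eq_zero h (f (hol i)) (hH j) (hH k) (hA l),
    HermitianCalculus.ip_dtor_eq_zero h (f (hol j)) (hH k) (hH i) (hA l),
    HermitianCalculus.ip_dtor_eq_zero h (f (hol k)) (hH i) (hH j) (hA l), map_zero] at b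
  linear_combination b

theorem curv_lc_eq_curv_nab
    {g : ContMDiffRiemannianMetric I ∞ E (fun x : M => TangentSpace I x)}
    {J : AlmostComplexStructure I M} (hJ : IsAlmostHermitian g J)
    {D : CovariantDerivative I E (TangentSpace I : M → Type _)} (hD : IsLeviCivita g D)
    {nab : CovariantDerivative I E (TangentSpace I : M → Type _)} (hnab : IsCanonical g J nab)
    {n : ℕ} {e : Fin n → CField I M} (he : IsUnitaryFrameOn g J e U)
    (hE : Module.finrank ℝ E = 2 * n)
    (h : ∀ X Y Z : Cplx (SField I U),
      (fieldCalculus hJ hD hnab U).Hol X → (fieldCalculus hJ hD hnab U).Anti Y →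
      (fieldCalculus hJ hD hnab U).Anti Z →
      (fieldCalculus hJ hD hnab U).ip ((fieldCalculus hJ hD hnab U).tor Y Z) X = 0)
    {p : M} (hp : p ∈ U) (i j k l : Fin n) :
    curv g D e p (hol i) (hol j) (hol k) (bar l)
      = curv g nab e p (hol k) (bar l) (hol i) (hol j) := by
  have h' := tor_hol_of_tor_anti hJ hD hnab h
  have hH := hol_smoothFrame hJ hD hnab he
  have hA := anti_smoothFrame hJ hD hnab he
  have z1 : ∀ a b c, tor g nab e p (hol a) (hol b) (hol c) = 0 := fun a b c => by
    rw [tor_eq hJ hD hnab he hp, Idx.conj, h' _ _ _ (hH a) (hH b) (hA c), map_zero]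
  have z2 : ∀ a b c, tor g nab e p (bar a) (bar b) (bar c) = 0 := fun a b c => by
    rw [tor_eq hJ hD hnab he hp, Idx.conj, h _ _ _ (hH c) (hA a) (hA b), map_zero]
  have z3 : dtor g nab e p (hol i) (hol j) (hol k) (hol l) = 0 := by
    rw [dtor_eq hJ hD hnab he hp, Idx.conj,
      HermitianCalculus.ip_dtor_eq_zero h' _ (hH i) (hH j) (hA l), map_zero]
  have hc := curv_nab_cyclic hJ hD hnab he hE h' hp i j k l
  rw [curv_lc_formula hJ hD hnab he hE hp]
  simp only [z1, z2, z3, mul_zero, zero_mul, sub_zero, Finset.sum_const_zero, add_zero]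
  -- Only ½(R_{kl̄ij} - R_{il̄jk} - R_{jl̄ki}) is left, and the cyclic identity makes the last two
  -- terms add up to R_{kl̄ij}.
  linear_combination -(1 / 2) * hc

theorem curv_lc_eq_zero
    {g : ContMDiffRiemannianMetric I ∞ E (fun x : M => TangentSpace I x)}
    {J : AlmostComplexStructure I M} (hJ : IsAlmostHermitian g J)
    {D : CovariantDerivative I E (TangentSpace I : M → Type _)} (hD : IsLeviCivita g D)
    {nab : CovariantDerivative I E (TangentSpace I : M → Type _)} (hnab : IsCanonical g J nab)
    {n : ℕ} {e : Fin n → CField I M} (he : IsUnitaryFrameOn g J e U)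
    (hE : Module.finrank ℝ E = 2 * n) (h : IsNearlyKahler J D) {p : M}
    (hp : p ∈ U) (i j k l : Fin n) :
    curv g D e p (hol i) (hol j) (hol k) (bar l) = 0 := by
  have hN := nearlyKahler_fieldCalculus (U := U) hJ hD hnab h
  have hq : ∀ X Y Z : Cplx (SField I U),
      (fieldCalculus hJ hD hnab U).Hol X → (fieldCalculus hJ hD hnab U).Anti Y →
      (fieldCalculus hJ hD hnab U).Anti Z →
      (fieldCalculus hJ hD hnab U).ip ((fieldCalculus hJ hD hnab U).tor Y Z) X = 0 :=
    fun X Y Z hX hY hZ => hN.tor_anti_anti hX hY hZ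
  rw [curv_lc_eq_curv_nab hJ hD hnab he hE hq hp]
  have hc := curv_nab_cyclic hJ hD hnab he hE (tor_hol_of_tor_anti hJ hD hnab hq) hp i j k l
  simp only [curv_nab_eq hJ hD hnab he hp] at hc ⊢
  have hH := hol_smoothFrame hJ hD hnab he
  have hA := anti_smoothFrame hJ hD hnab he
  have et := evalAt_ip_tor_expand hJ hD hnab he hp hE
  generalize fieldCalculus hJ hD hnab U = C at hN hq hc hH hA et ⊢
  generalize smoothFrame he.smooth = f at hc hH hA et ⊢
  -- Bianchi with the quadratic torsion term gone; the skewness of ∇_{l̄}τ in i, j, k thus passes to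
  -- the curvature.
  have hd : ∀ i j k, evalAt p (C.ip (C.curvNab (f (hol i)) (f (hol j)) (f (hol k))) (f (bar l)))
      = -evalAt p (C.ip (C.dtor (f (bar l)) (f (hol i)) (f (hol j))) (f (hol k))) := by
    intro i j k
    have htt : evalAt p (C.ip (C.tor (C.tor (f (hol i)) (f (hol j))) (f (bar l)))
        (f (hol k))) = 0 := by
      rw [et]
      refine Finset.sum_eq_zero fun a _ => ?_
      rw [hq _ _ _ (hH k) (hA a) (hA l), HermitianCalculus.tor_hol_anti (hH a) (hA l)]
      simp
    rw [HermitianCalculus.ip_dtor_anti (hH i) (hA l) (hH j) (hH k), map_sub, htt]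
    simp
  have s1 : ∀ i j k, C.ip (C.dtor (f (bar l)) (f (hol i)) (f (hol j))) (f (hol k))
      = -C.ip (C.dtor (f (bar l)) (f (hol k)) (f (hol j))) (f (hol i)) := fun i j k =>
    hN.dtor_hol _ (hH k) (hH i) (hH j)
  have s2 : ∀ i j k, C.ip (C.dtor (f (bar l)) (f (hol i)) (f (hol j))) (f (hol k))
      = -C.ip (C.dtor (f (bar l)) (f (hol j)) (f (hol i))) (f (hol k)) := fun i j k => by
    simp only [HermitianCalculus.dtor, map_sub, LinearMap.sub_apply,
      HermitianCalculus.tor_skew (f (hol j)), HermitianCalculus.tor_skew (C.nab _ (f (hol j))),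
      map_neg, LinearMap.neg_apply]
    abel
  rw [hd, hd, hd] at hc
  rw [hd]
  have e1 := congrArg (evalAt p) (s2 j k i)
  have e2 := congrArg (evalAt p) (s1 i j k)
  have e3 := congrArg (evalAt p) (s1 k i j)
  have e4 := congrArg (evalAt p) (s2 i j k)
  simp only [map_neg] at e1 e2 e3 e4
  -- Two transpositions make a cyclic permutation, so the cyclic sum is three times one term.
  linear_combination 1 / 3 * (hc + (e1 - e2) + (e3 - e4))

end AlmostHermitian

end

theorem mainTheorem7 {n : ℕ} {M : Type*} [TopologicalSpace M]
    [ChartedSpace (EuclideanSpace ℝ (Fin (2 * n))) M] [IsManifold (𝓡 (2 * n)) ∞ M]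
    (g : ContMDiffRiemannianMetric (𝓡 (2 * n)) ∞ (EuclideanSpace ℝ (Fin (2 * n)))
      (fun x : M => TangentSpace (𝓡 (2 * n)) x))
    (J : AlmostComplexStructure (𝓡 (2 * n)) M) (hJ : IsAlmostHermitian g J)
    (D : CovariantDerivative (𝓡 (2 * n)) (EuclideanSpace ℝ (Fin (2 * n)))
      (TangentSpace (𝓡 (2 * n)) : M → Type _)) (hD : IsLeviCivita g D)
    (nab : CovariantDerivative (𝓡 (2 * n)) (EuclideanSpace ℝ (Fin (2 * n)))
      (TangentSpace (𝓡 (2 * n)) : M → Type _)) (hnab : IsCanonical g J nab)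
    (U : Set M) (hU : IsOpen U) (e : Fin n → CField (𝓡 (2 * n)) M)
    (he : IsUnitaryFrameOn g J e U) (p : M) (hp : p ∈ U) :
    (∀ i j k l : Fin n,
      curv g D e p (hol i) (hol j) (hol k) (bar l) =
        1 / 2 * (curv g nab e p (hol k) (bar l) (hol i) (hol j) - curv g nab e p (hol i) (bar l) (hol j) (hol k)
            - curv g nab e p (hol j) (bar l) (hol k) (hol i))
        + 1 / 2 * (dtor g nab e p (hol i) (hol j) (hol k) (hol l)
            - ∑ a, tor g nab e p (hol i) (hol j) (bar a) * tor g nab e p (bar l) (bar a) (bar k))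
        + 1 / 4 * ∑ a, (tor g nab e p (hol j) (hol a) (hol l) * tor g nab e p (hol i) (hol k) (hol a)
            - tor g nab e p (hol i) (hol a) (hol l) * tor g nab e p (hol j) (hol k) (hol a))
        + 1 / 4 * ∑ a, tor g nab e p (bar l) (bar a) (bar i) *
            (tor g nab e p (hol j) (hol k) (bar a) - tor g nab e p (hol k) (hol a) (bar j) + tor g nab e p (hol a) (hol j) (bar k))
        - 1 / 4 * ∑ a, tor g nab e p (bar l) (bar a) (bar j) *
            (tor g nab e p (hol i) (hol k) (bar a) - tor g nab e p (hol k) (hol a) (bar i)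
              + tor g nab e p (hol a) (hol i) (bar k))) ∧
    (IsQuasiKahler g J → ∀ i j k l : Fin n,
      curv g D e p (hol i) (hol j) (hol k) (bar l) = curv g nab e p (hol k) (bar l) (hol i) (hol j)) ∧
    (IsNearlyKahler J D → ∀ i j k l : Fin n,
      curv g D e p (hol i) (hol j) (hol k) (bar l) = 0) := by
  have hE : Module.finrank ℝ (EuclideanSpace ℝ (Fin (2 * n))) = 2 * n := by simp
  have he' : IsUnitaryFrameOn g J e (⟨U, hU⟩ : TopologicalSpace.Opens M) := he
  have hp' : p ∈ (⟨U, hU⟩ : TopologicalSpace.Opens M) := hp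
  refine ⟨fun i j k l => curv_lc_formula hJ hD hnab he' hE hp' i j k l,
    fun h i j k l => curv_lc_eq_curv_nab hJ hD hnab he' hE
      (fun X Y Z hX hY hZ => tor_anti_of_quasiKahler hJ hD hnab h hX hY hZ) hp' i j k l,
    fun h i j k l => curv_lc_eq_zero hJ hD hnab he' hE h hp' i j k l⟩
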